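/- Let $\Gamma$ be a non-trivial countable nilpotent group that is torsion-free (no element other than the identity has finite order) and that is not a rank-one abelian group, where the rank of a torsion-free abelian group is the minimal dimension of a $\mathbb{Q}$-vector space in which the group embeds. Let $\mathcal{O}(\Gamma)$ be the set of all left-invariant total orders $\preceq$ on $\Gamma$, with the topology that has the sets $U_{f,g}=\{\preceq\ :\ f\prec g\}$, $f,g\in\Gamma$, as a sub-basis. Then $\mathcal{O}(\Gamma)$ is homeomorphic to the Cantor set. Consequently, for each left-invariant total order $\preceq$ on $\Gamma$, the semigroup $\{g\in\Gamma : g\succ \mathrm{id}\}$ is not finitely generated. -/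

import Mathlib

/-- An ordering of a group `G`: a left-invariant total order relation on `G`. -/
@[ext]
structure GroupOrdering (G : Type*) [Group G] where
  /-- The relation `f ≼ g`. -/
  le : G → G → Prop
  le_refl : ∀ f, le f f
  le_trans : ∀ f g h, le f g → le g h → le f h
  le_antisymm : ∀ f g, le f g → le g f → f = g
  le_total : ∀ f g, le f g ∨ le g f
  mul_le_mul_left : ∀ f g h, le g h → le (f * g) (f * h)

namespace GroupOrdering

variable {G : Type*} [Group G]

/-- The strict relation `f ≺ g`. -/
def lt (o : GroupOrdering G) (f g : G) : Prop := o.le f g ∧ f ≠ g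

/-- The topology on the space of orderings: the sets `{≼ : f ≺ g}`, for `f g : G`, form a
sub-basis. -/
instance : TopologicalSpace (GroupOrdering G) :=
  TopologicalSpace.generateFrom {U | ∃ f g : G, U = {o : GroupOrdering G | o.lt f g}}

/-- The positive cone `{g : 1 ≺ g}` of an ordering, as a subsemigroup of the group. -/
def positiveCone (o : GroupOrdering G) : Subsemigroup G where
  carrier := {g | o.lt 1 g}
  mul_mem' := by
    rintro a b ⟨ha, ha'⟩ ⟨hb, hb'⟩
    have h : o.le a (a * b) := by simpa using o.mul_le_mul_left a 1 b hb
    refine ⟨o.le_trans _ _ _ ha h, fun e => ha' ?_⟩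
    exact o.le_antisymm _ _ ha (by rw [e]; exact h)

end GroupOrdering

/-- The rank of a torsion-free abelian group `G` (written multiplicatively): the minimal dimension
of a `ℚ`-vector space in which `G` embeds as a group. (For a group that embeds in no `ℚ`-vector
space the value is the junk value `0`.) -/
noncomputable def torsionFreeAbelianRank.{u} (G : Type u) [Group G] : Cardinal.{u} :=
  sInf {c | ∃ (V : Type u) (_ : AddCommGroup V) (_ : Module ℚ V) (φ : Additive G →+ V),
    Function.Injective φ ∧ c = Module.rank ℚ V}

/-- `G` is a rank-one abelian group. -/
def IsRankOneAbelian (G : Type*) [Group G] : Prop :=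
  (∀ a b : G, a * b = b * a) ∧ torsionFreeAbelianRank G = 1

/-!
The proof rests on Conrad's property of left-ordered nilpotent groups (`exists_lt_mul_pow`): if
`f` and `g` are positive, then `g < f * g ^ n` for some `n`. Otherwise all words in `f` and `g`
starting with `f` would lie below all words starting with `g`, which contradicts the semigroup law
that Malcev found in nilpotent groups. It follows that, for `g` positive, the largest convex
subgroup omitting `g` is normal in the smallest convex subgroup containing `g`, and that the
quotient is Archimedean, hence abelian.

An ordering is an isolated point of the space of orderings if and only if it is the only one that
makes a certain finite set `F` positive (`IsDeterminedBy`). The order can be altered on a convex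
subgroup, or on the quotient by a convex normal subgroup, without affecting the rest, so being
determined passes to these. An abelian group with a determined order has rank one
(`IsDeterminedBy.rankLeOne`): all positive elements have powers in the semigroup generated by `F`,
and the largest element of `F` is redundant in this. Applied to a nilpotent group, this gives a
least nontrivial convex subgroup `C`, abelian of rank one. If `C` were proper, there would be a
convex subgroup `D` in which `C` is normal, and the same argument in `D ⧸ C` would yield a convex
subgroup `E` such that `C` and `E ⧸ C` have rank one. Nilpotency makes `E` abelian, its order is
determined, so `E` has rank one, which is absurd because its proper nontrivial subgroup `C` is
closed under roots. Hence only rank-one abelian groups have isolated orderings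
(`GroupOrdering.not_isOpen_singleton`).

Orderings exist, by lexicographic extension along the center, and they form a compact space whose
points are separated by countably many clopen sets. Without isolated points, such a space is the
Cantor set (`nonempty_homeomorph_cantorSet`). Finally, an ordering with a finitely generated
positive cone would be isolated.
-/

open Subgroup (center mem_center_iff mem_top mem_bot bot_or_exists_ne_one)
open scoped commutatorElement

/-! ### Nilpotent groups -/

section NilpotentGroups

variable {G : Type*} [Group G]

theorem commutatorElement_mem_upperCentralSeries_left {n : ℕ} {x : G}
    (hx : x ∈ Subgroup.upperCentralSeries G (n + 1)) (y : G) :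
    ⁅x, y⁆ ∈ Subgroup.upperCentralSeries G n :=
  Subgroup.mem_upperCentralSeries_succ_iff.1 hx y

theorem commutatorElement_mem_upperCentralSeries_right {n : ℕ} {x : G}
    (hx : x ∈ Subgroup.upperCentralSeries G (n + 1)) (y : G) :
    ⁅y, x⁆ ∈ Subgroup.upperCentralSeries G n := by
  rw [← commutatorElement_inv]
  exact inv_mem (commutatorElement_mem_upperCentralSeries_left hx y)

theorem pow_mul_eq_of_mul_eq {a d e : G} (hea : Commute e a) (h : a * d = e * d * a) (n : ℕ) :
    a ^ n * d = e ^ n * d * a ^ n := by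
  induction n with
  | zero => simp
  | succ n ih =>
    calc a ^ (n + 1) * d = a ^ n * (a * d) := by rw [pow_succ, mul_assoc]
      _ = (a ^ n * e) * d * a := by rw [h]; group
      _ = e * (a ^ n * d) * a := by rw [← (hea.pow_right n).eq]; group
      _ = e ^ (n + 1) * d * a ^ (n + 1) := by rw [ih, pow_succ' e, pow_succ a]; group

theorem pow_mul_pow_eq_of_mul_eq {a d e : G} (hea : Commute e a) (hed : Commute e d)
    (h : a * d = e * d * a) (n : ℕ) : a ^ n * d ^ n = e ^ (n * n) * d ^ n * a ^ n := by
  have h1 := pow_mul_eq_of_mul_eq hea h n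
  have h2 : d * a ^ n = (e ^ n)⁻¹ * a ^ n * d := by rw [mul_assoc, h1]; group
  have h3 := pow_mul_eq_of_mul_eq (hed.pow_left n).inv_left h2 n
  rw [inv_pow, ← pow_mul] at h3
  rw [mul_assoc, h3]
  group

/-- In a torsion-free nilpotent group the centralizer of an element is closed under taking
roots. -/
theorem commute_of_commute_pow [Group.IsNilpotent G]
    (tf : ∀ g : G, g ≠ 1 → ¬ IsOfFinOrder g) {a b : G} {n : ℕ} (hn : n ≠ 0)
    (h : Commute (a ^ n) b) : Commute a b := by
  have key : ∀ k : ℕ, ∀ b ∈ Subgroup.upperCentralSeries G k, Commute (a ^ n) b → Commute a b := by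
    intro k
    induction k with
    | zero =>
      intro b hb _
      rw [Subgroup.upperCentralSeries_zero, mem_bot] at hb
      rw [hb]; exact Commute.one_right a
    | succ k ih =>
      intro b hb hab
      have hw : Commute (a ^ n) ⁅a, b⁆ := by
        rw [commutatorElement_def]
        have ha := Commute.pow_self a n
        exact ((ha.mul_right hab).mul_right ha.inv_right).mul_right hab.inv_right
      have haw := ih _ (commutatorElement_mem_upperCentralSeries_right hb a) hw
      have h1 : a * b = ⁅a, b⁆ * b * a := by rw [commutatorElement_def]; group
      have h2 := pow_mul_eq_of_mul_eq haw.symm h1 n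
      rw [hab.eq, mul_assoc, hab.symm.eq, hab.eq, right_eq_mul] at h2
      by_contra hne
      refine tf ⁅a, b⁆ (fun h => hne ?_) (isOfFinOrder_iff_pow_eq_one.2
        ⟨n, Nat.pos_of_ne_zero hn, h2⟩)
      exact commutatorElement_eq_one_iff_commute.1 h
  obtain ⟨k, hk⟩ := Group.IsNilpotent.nilpotent G
  exact key k b (hk ▸ mem_top b) h

theorem mem_center_of_pow_mem_center [Group.IsNilpotent G]
    (tf : ∀ g : G, g ≠ 1 → ¬ IsOfFinOrder g) {a : G} {n : ℕ} (hn : n ≠ 0)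
    (h : a ^ n ∈ center G) : a ∈ center G := by
  rw [mem_center_iff] at h ⊢
  exact fun b => (commute_of_commute_pow tf hn (show Commute (a ^ n) b from (h b).symm)).eq.symm

theorem torsionFree_quotient_center [Group.IsNilpotent G]
    (tf : ∀ g : G, g ≠ 1 → ¬ IsOfFinOrder g) :
    ∀ q : G ⧸ center G, q ≠ 1 → ¬ IsOfFinOrder q := by
  intro q hq hfin
  obtain ⟨g, rfl⟩ := QuotientGroup.mk_surjective q
  obtain ⟨n, hn, h⟩ := isOfFinOrder_iff_pow_eq_one.1 hfin
  rw [← QuotientGroup.mk_pow, QuotientGroup.eq_one_iff] at h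
  exact hq ((QuotientGroup.eq_one_iff g).2 (mem_center_of_pow_mem_center tf hn.ne' h))

theorem exists_mem_center_of_normal [Group.IsNilpotent G] {N : Subgroup G} (hN : N.Normal)
    (hne : N ≠ ⊥) : ∃ z ∈ N, z ∈ center G ∧ z ≠ 1 := by
  have key : ∀ k : ℕ, ∀ x ∈ Subgroup.upperCentralSeries G k, x ∈ N → x ≠ 1 →
      ∃ z ∈ N, z ∈ center G ∧ z ≠ 1 := by
    intro k
    induction k with
    | zero =>
      intro x hx _ hx1
      rw [Subgroup.upperCentralSeries_zero, mem_bot] at hx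
      exact absurd hx hx1
    | succ k ih =>
      intro x hx hxN hx1
      by_cases hall : ∀ y : G, ⁅x, y⁆ = 1
      · refine ⟨x, hxN, mem_center_iff.2 fun y => ?_, hx1⟩
        exact (commutatorElement_eq_one_iff_commute.1 (hall y)).eq.symm
      · push Not at hall
        obtain ⟨y, hy⟩ := hall
        refine ih _ (commutatorElement_mem_upperCentralSeries_left hx y) ?_ hy
        rw [commutatorElement_def, mul_assoc x, mul_assoc x]
        exact N.mul_mem hxN (hN.conj_mem _ (N.inv_mem hxN) y)
  obtain ⟨k, hk⟩ := Group.IsNilpotent.nilpotent G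
  obtain ⟨x, hx, hx1⟩ := (bot_or_exists_ne_one N).resolve_left hne
  exact key k x (hk ▸ mem_top x) hx hx1

/-- The pairs of Thue–Morse words in two letters `x` and `y`, evaluated in a group: each word is
followed by the other one. -/
def thueMorsePair (x y : G) : ℕ → G × G
  | 0 => (x, y)
  | n + 1 => ((thueMorsePair x y n).1 * (thueMorsePair x y n).2,
      (thueMorsePair x y n).2 * (thueMorsePair x y n).1)

/-- Malcev's semigroup law. The quotient of the two words of a Thue–Morse pair is the commutator of
the previous two words, so it moves one step down the upper central series each time. -/
theorem exists_thueMorsePair_eq [Group.IsNilpotent G] (x y : G) :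
    ∃ n, (thueMorsePair x y n).1 = (thueMorsePair x y n).2 := by
  obtain ⟨c, hc⟩ := Group.IsNilpotent.nilpotent G
  have key : ∀ n k, n + k = c → (thueMorsePair x y n).1 * (thueMorsePair x y n).2⁻¹ ∈
      Subgroup.upperCentralSeries G k := by
    intro n
    induction n with
    | zero => intro k hk; rw [← hk, zero_add] at hc; rw [hc]; exact mem_top _
    | succ n ih =>
      intro k hk
      have := commutatorElement_mem_upperCentralSeries_left (ih (k + 1) (by omega))
        (thueMorsePair x y n).2
      rw [commutatorElement_def] at this
      convert this using 1
      simp only [thueMorsePair]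
      group
  refine ⟨c, ?_⟩
  have := key c 0 rfl
  rwa [Subgroup.upperCentralSeries_zero, mem_bot, mul_inv_eq_one] at this

end NilpotentGroups

/-! ### Left-ordered nilpotent groups and their convex subgroups -/

section LeftOrderedGroups

variable {G : Type*} [Group G] [LinearOrder G]

theorem Subgroup.mem_of_one_lt_of_le {C : Subgroup G} (hC : (C : Set G).OrdConnected) {x y : G}
    (hx : 1 < x) (hxy : x ≤ y) (hy : y ∈ C) : x ∈ C :=
  hC.out C.one_mem hy ⟨hx.le, hxy⟩

theorem ordConnected_subgroupOf {C D : Subgroup G} (hC : (C : Set G).OrdConnected) :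
    (C.subgroupOf D : Set D).OrdConnected :=
  ⟨fun _ ha _ hb _ hx => hC.out ha hb hx⟩

/-- The smallest convex subgroup containing a given element. -/
def leastConvex (g : G) : Subgroup G := sInf {C | (C : Set G).OrdConnected ∧ g ∈ C}

/-- The largest convex subgroup omitting a given element `g ≠ 1`. -/
def greatestConvexOmitting (g : G) : Subgroup G := sSup {C | (C : Set G).OrdConnected ∧ g ∉ C}

theorem mem_leastConvex (g : G) : g ∈ leastConvex g :=
  Subgroup.mem_sInf.2 fun _ hC => hC.2

theorem leastConvex_le {g : G} {C : Subgroup G} (hC : (C : Set G).OrdConnected) (hg : g ∈ C) :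
    leastConvex g ≤ C := sInf_le ⟨hC, hg⟩

theorem ordConnected_leastConvex (g : G) : (leastConvex g : Set G).OrdConnected := by
  refine ⟨fun a ha b hb x hx => Subgroup.mem_sInf.2 fun C hC => ?_⟩
  exact hC.1.out (Subgroup.mem_sInf.1 ha C hC) (Subgroup.mem_sInf.1 hb C hC) hx

theorem le_greatestConvexOmitting {g : G} {C : Subgroup G} (hC : (C : Set G).OrdConnected)
    (hg : g ∉ C) : C ≤ greatestConvexOmitting g := le_sSup ⟨hC, hg⟩

variable [MulLeftMono G]

/-- Conrad's property of left-ordered nilpotent groups. If `f * g ^ n ≤ g` for all `n`, then every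
word in `f` and `g` starting with `f` lies below `g`, while every word starting with `g` lies above
`g`; the two words in Malcev's law start with different letters. -/
theorem exists_lt_mul_pow [Group.IsNilpotent G] {f g : G} (hf : 1 < f) (hg : 1 < g) :
    ∃ n : ℕ, g < f * g ^ n := by
  by_contra! hle
  have hlt : ∀ n : ℕ, f * g ^ n < g := fun n =>
    lt_of_lt_of_le (mul_lt_mul_right (pow_lt_pow_right' hg n.lt_succ_self) f) (hle (n + 1))
  let M : Submonoid G := Submonoid.closure {f, g}
  have hfM : f ∈ M := Submonoid.subset_closure (by simp)
  have hgM : g ∈ M := Submonoid.subset_closure (by simp)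
  have bound : ∀ w ∈ M, 1 ≤ w ∧ ∃ m : ℕ, w ≤ g ^ m := by
    intro w hw
    induction hw using Submonoid.closure_induction_left with
    | one => exact ⟨le_rfl, 0, by simp⟩
    | mul_left x hx y hy ih =>
      obtain ⟨h1, m, hm⟩ := ih
      rcases hx with rfl | rfl
      · exact ⟨Left.one_le_mul hf.le h1, 1,
          by simpa using (mul_le_mul_right hm x).trans (hle m)⟩
      · exact ⟨Left.one_le_mul hg.le h1, m + 1,
          by simpa [pow_succ'] using mul_le_mul_right hm x⟩
  have words : ∀ n, (∃ w ∈ M, (thueMorsePair f g n).1 = f * w) ∧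
      ∃ w ∈ M, (thueMorsePair f g n).2 = g * w := by
    intro n
    induction n with
    | zero => exact ⟨⟨1, M.one_mem, by simp [thueMorsePair]⟩, 1, M.one_mem, by simp [thueMorsePair]⟩
    | succ n ih =>
      obtain ⟨⟨u, hu, hu'⟩, v, hv, hv'⟩ := ih
      refine ⟨⟨u * (g * v), M.mul_mem hu (M.mul_mem hgM hv), ?_⟩,
        v * (f * u), M.mul_mem hv (M.mul_mem hfM hu), ?_⟩
      · simp only [thueMorsePair, hu', hv', mul_assoc]
      · simp only [thueMorsePair, hu', hv', mul_assoc]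
  obtain ⟨n, hn⟩ := exists_thueMorsePair_eq f g
  obtain ⟨⟨u, hu, hu'⟩, v, hv, hv'⟩ := words n
  obtain ⟨-, m, hm⟩ := bound u hu
  have h1 : f * u < g := lt_of_le_of_lt (mul_le_mul_right hm f) (hlt m)
  have h2 : g ≤ g * v := by simpa using mul_le_mul_right (bound v hv).1 g
  rw [hu', hv'] at hn
  exact (h1.trans_le h2).ne hn

/-- In Conrad's property the exponent can always be taken to be `2`. -/
theorem lt_mul_sq [Group.IsNilpotent G] {f g : G} (hf : 1 < f) (hg : 1 < g) :
    g < f * g ^ 2 := by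
  by_contra! hle
  -- With `u = f * g` the assumption reads `u * g ≤ g`, which bounds all powers of `u` by `g`.
  have hu : 1 < f * g := Left.one_lt_mul hf hg
  have hug : ∀ n : ℕ, (f * g) ^ n * g ≤ g := by
    intro n
    induction n with
    | zero => simp
    | succ n ih =>
      calc (f * g) ^ (n + 1) * g = (f * g) ^ n * (f * g ^ 2) := by rw [pow_succ, sq]; group
        _ ≤ (f * g) ^ n * g := mul_le_mul_right hle _
        _ ≤ g := ih
  obtain ⟨n, hn⟩ := exists_lt_mul_pow hf hu
  have : (f * g) ^ n < g := lt_of_lt_of_le (lt_mul_of_one_lt_right' _ hg) (hug n)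
  exact (hn.trans (mul_lt_mul_right this f)).false

theorem not_isOfFinOrder_of_leftOrdered (g : G) (hg : g ≠ 1) : ¬ IsOfFinOrder g := by
  intro h
  obtain ⟨n, hn, h⟩ := isOfFinOrder_iff_pow_eq_one.1 h
  rcases lt_or_gt_of_ne hg with h1 | h1
  · have := one_lt_pow' (Left.one_lt_inv_iff.2 h1) hn.ne'
    rw [inv_pow, h, inv_one] at this
    exact this.false
  · exact (one_lt_pow' h1 hn.ne').ne' h

theorem Subgroup.mem_of_pow_mem_of_ordConnected {C : Subgroup G} (hC : (C : Set G).OrdConnected)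
    {g : G} {n : ℕ} (hn : n ≠ 0) (h : g ^ n ∈ C) : g ∈ C := by
  have key : ∀ g : G, 1 ≤ g → g ^ n ∈ C → g ∈ C := fun g h1 h =>
    hC.out C.one_mem h ⟨h1, by simpa using pow_le_pow_right' h1 (Nat.one_le_iff_ne_zero.2 hn)⟩
  rcases le_total 1 g with h1 | h1
  · exact key g h1 h
  · exact inv_mem_iff.1 (key g⁻¹ (Left.one_le_inv_iff.2 h1) (by rw [inv_pow]; exact C.inv_mem h))

theorem Subgroup.le_of_forall_one_lt {C D : Subgroup G} (h : ∀ x, 1 < x → x ∈ C → x ∈ D) :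
    C ≤ D := by
  intro x hx
  rcases lt_trichotomy x 1 with h1 | rfl | h1
  · exact inv_mem_iff.1 (h x⁻¹ (Left.one_lt_inv_iff.2 h1) (C.inv_mem hx))
  · exact D.one_mem
  · exact h x h1 hx

theorem Subgroup.exists_one_lt_mem_notMem {C D : Subgroup G} (h : ¬ C ≤ D) :
    ∃ x, 1 < x ∧ x ∈ C ∧ x ∉ D := by
  by_contra! h'
  exact h (Subgroup.le_of_forall_one_lt fun x hx hxC => h' x hx hxC)

theorem Subgroup.ordConnected_of_forall {C : Subgroup G}
    (h : ∀ x y, 1 < x → x ≤ y → y ∈ C → x ∈ C) : (C : Set G).OrdConnected := by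
  refine ⟨fun a ha b hb x hx => ?_⟩
  have h1 : a⁻¹ * x ∈ C := by
    rcases hx.1.eq_or_lt with rfl | h1
    · simp
    · exact h _ (a⁻¹ * b) (lt_inv_mul_iff_lt.2 h1) (mul_le_mul_right hx.2 _)
        (C.mul_mem (C.inv_mem ha) hb)
  simpa using C.mul_mem ha h1

/-- The convex subgroups of a left-ordered group form a chain. -/
theorem Subgroup.le_total_of_ordConnected {C D : Subgroup G} (hC : (C : Set G).OrdConnected)
    (hD : (D : Set G).OrdConnected) : C ≤ D ∨ D ≤ C := by
  by_contra! h
  obtain ⟨x, hx, hxC, hxD⟩ := Subgroup.exists_one_lt_mem_notMem h.1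
  obtain ⟨y, hy, hyD, hyC⟩ := Subgroup.exists_one_lt_mem_notMem h.2
  rcases le_total x y with hxy | hxy
  · exact hxD (Subgroup.mem_of_one_lt_of_le hD hx hxy hyD)
  · exact hyC (Subgroup.mem_of_one_lt_of_le hC hy hxy hxC)

theorem mem_greatestConvexOmitting {g x : G} (hg : g ≠ 1) : x ∈ greatestConvexOmitting g ↔
    ∃ C : Subgroup G, ((C : Set G).OrdConnected ∧ g ∉ C) ∧ x ∈ C := by
  have hne : {C : Subgroup G | (C : Set G).OrdConnected ∧ g ∉ C}.Nonempty :=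
    ⟨⊥, by rw [Subgroup.coe_bot]; exact Set.ordConnected_singleton, by rwa [mem_bot]⟩
  have hdir : DirectedOn (· ≤ ·) {C : Subgroup G | (C : Set G).OrdConnected ∧ g ∉ C} := by
    intro C hC D hD
    rcases Subgroup.le_total_of_ordConnected hC.1 hD.1 with h | h
    · exact ⟨D, hD, h, le_rfl⟩
    · exact ⟨C, hC, le_rfl, h⟩
  exact Subgroup.mem_sSup_of_directedOn hne hdir

theorem notMem_greatestConvexOmitting {g : G} (hg : g ≠ 1) : g ∉ greatestConvexOmitting g := by
  intro h
  obtain ⟨C, hC, hgC⟩ := (mem_greatestConvexOmitting hg).1 h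
  exact hC.2 hgC

theorem ordConnected_greatestConvexOmitting {g : G} (hg : g ≠ 1) :
    (greatestConvexOmitting g : Set G).OrdConnected := by
  refine Subgroup.ordConnected_of_forall fun x y hx hxy hy => ?_
  obtain ⟨C, hC, hyC⟩ := (mem_greatestConvexOmitting hg).1 hy
  exact le_greatestConvexOmitting hC.1 hC.2 (Subgroup.mem_of_one_lt_of_le hC.1 hx hxy hyC)

theorem greatestConvexOmitting_le_leastConvex {g : G} (hg : g ≠ 1) :
    greatestConvexOmitting g ≤ leastConvex g :=
  (Subgroup.le_total_of_ordConnected (ordConnected_greatestConvexOmitting hg)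
    (ordConnected_leastConvex g)).resolve_right
    fun h => notMem_greatestConvexOmitting hg (h (mem_leastConvex g))

/-- By Conrad's property, the elements bounded by the powers of `g` form a subgroup, which is
visibly convex. -/
theorem exists_le_pow_of_mem_leastConvex [Group.IsNilpotent G] {g h : G} (hg : 1 < g)
    (hh : h ∈ leastConvex g) : ∃ n : ℕ, h ≤ g ^ n := by
  have key : ∀ h : G, ∀ n m : ℕ, h ≤ g ^ n → ∃ N : ℕ, h * g ^ m ≤ g ^ N := by
    intro h n m hn
    rcases hn.eq_or_lt with rfl | hn
    · exact ⟨n + m, (pow_add g n m).ge⟩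
    · by_contra! hlt
      have hm : 1 < g ^ (m + 1) := one_lt_pow' hg m.succ_ne_zero
      obtain ⟨k, hk⟩ := exists_lt_mul_pow (lt_inv_mul_iff_lt.2 hn) hm
      have := hlt (n + (m + 1) * k)
      rw [pow_add, pow_mul] at this
      rw [mul_assoc, lt_inv_mul_iff_mul_lt] at hk
      exact (hk.trans (this.trans (mul_lt_mul_right (pow_lt_pow_right' hg m.lt_succ_self) h))).false
  let S : Subgroup G :=
    { carrier := {h | (∃ n : ℕ, h ≤ g ^ n) ∧ ∃ n : ℕ, h⁻¹ ≤ g ^ n}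
      one_mem' := ⟨⟨0, by simp⟩, 0, by simp⟩
      inv_mem' := fun {x} hx => ⟨hx.2, by simpa using hx.1⟩
      mul_mem' := by
        rintro a b ⟨⟨n, hn⟩, n', hn'⟩ ⟨⟨m, hm⟩, m', hm'⟩
        obtain ⟨N, hN⟩ := key a n m hn
        obtain ⟨N', hN'⟩ := key b⁻¹ m' n' hm'
        refine ⟨⟨N, (mul_le_mul_right hm a).trans hN⟩, N', ?_⟩
        rw [mul_inv_rev]
        exact (mul_le_mul_right hn' _).trans hN' }
  have hS : (S : Set G).OrdConnected := by
    refine Subgroup.ordConnected_of_forall fun x y hx hxy hy => ?_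
    obtain ⟨n, hn⟩ := hy.1
    exact ⟨⟨n, hxy.trans hn⟩, 0, by simpa using hx.le⟩
  exact (leastConvex_le hS ⟨⟨1, by simp⟩, 0, by simpa using hg.le⟩ hh).1

/-- In a left-ordered nilpotent group, the largest convex subgroup omitting `g` is normalized by the
smallest convex subgroup containing `g`. -/
theorem conj_mem_greatestConvexOmitting [Group.IsNilpotent G] {g c d : G} (hg : 1 < g)
    (hc : c ∈ greatestConvexOmitting g) (hd : d ∈ leastConvex g) :
    d * c * d⁻¹ ∈ greatestConvexOmitting g := by
  set C := greatestConvexOmitting g with hCdef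
  have hC : (C : Set G).OrdConnected := ordConnected_greatestConvexOmitting hg.ne'
  -- Positive elements of `leastConvex g` outside `C` are Archimedean equivalent.
  have arch : ∀ x y, 1 < x → x ∉ C → y ∈ leastConvex g → ∃ n : ℕ, y ≤ x ^ n := by
    intro x y hx hxC hy
    refine exists_le_pow_of_mem_leastConvex hx (leastConvex_le (ordConnected_leastConvex x) ?_ hy)
    by_contra hgx
    exact hxC (le_greatestConvexOmitting (ordConnected_leastConvex x) hgx (mem_leastConvex x))
  have hCD : C ≤ leastConvex g := greatestConvexOmitting_le_leastConvex hg.ne'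
  -- An element outside `C` lies on the same side of all of `C`.
  have side : ∀ x c, 1 < x → x ∉ C → c ∈ C → c < x := by
    intro x c hx hxC hc
    by_contra! hle
    exact hxC (Subgroup.mem_of_one_lt_of_le hC hx hle hc)
  -- If `d * c * d⁻¹` lay above `C`, some power of it would exceed `d`, so that `d⁻¹` would lie
  -- between the elements `(c ^ n)⁻¹` and `1` of `C`.
  have conj : ∀ d c, 1 < d → d ∉ C → d ∈ leastConvex g → c ∈ C → 1 < d * c * d⁻¹ →
      d * c * d⁻¹ ∈ C := by
    intro d c hd hdC hdg hc h1
    by_contra hne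
    obtain ⟨n, hn⟩ := arch _ d h1 hne hdg
    rw [conj_pow, mul_assoc, le_mul_iff_one_le_right'] at hn
    have h2 : (c ^ n)⁻¹ ≤ d⁻¹ := by simpa using mul_le_mul_right hn (c ^ n)⁻¹
    exact hdC (inv_mem_iff.1 (hC.out (C.inv_mem (C.pow_mem hc n)) C.one_mem
      ⟨h2, (Left.inv_lt_one_iff.2 hd).le⟩))
  -- If `d⁻¹ * c * d` lay above `C`, some power of it would exceed `d ^ 2`, which contradicts
  -- `d < f * d ^ 2` for the positive element `f = (c ^ n)⁻¹ * d`.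
  have conj' : ∀ d c, 1 < d → d ∉ C → d ∈ leastConvex g → c ∈ C → 1 < d⁻¹ * c * d →
      d⁻¹ * c * d ∈ C := by
    intro d c hd hdC hdg hc h1
    by_contra hne
    obtain ⟨n, hn⟩ := arch _ (d ^ 2) h1 hne ((leastConvex g).pow_mem hdg 2)
    have hpow : (d⁻¹ * c * d) ^ n = d⁻¹ * (c ^ n * d) := by
      have := conj_pow (i := n) (a := d⁻¹) (b := c)
      rw [inv_inv] at this
      rw [this, mul_assoc]
    have hf : 1 < (c ^ n)⁻¹ * d := lt_inv_mul_iff_lt.2 (side d _ hd hdC (C.pow_mem hc n))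
    have h2 := lt_mul_sq hf hd
    rw [mul_assoc, lt_inv_mul_iff_mul_lt] at h2
    rw [hpow] at hn
    have h3 := mul_le_mul_right hn d
    rw [mul_inv_cancel_left] at h3
    exact (h2.trans_le h3).false
  have all : ∀ c ∈ C, 1 < d * c * d⁻¹ → d * c * d⁻¹ ∈ C := by
    intro c hc h1
    by_cases hdC : d ∈ C
    · exact C.mul_mem (C.mul_mem hdC hc) (C.inv_mem hdC)
    rcases lt_trichotomy d 1 with hd1 | rfl | hd1
    · have := conj' d⁻¹ c (Left.one_lt_inv_iff.2 hd1) (fun h => hdC (inv_mem_iff.1 h))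
        (inv_mem hd) hc (by simpa using h1)
      simpa using this
    · simpa using hc
    · exact conj d c hd1 hdC hd hc h1
  rcases lt_trichotomy (d * c * d⁻¹) 1 with h1 | h1 | h1
  · have h2 : (d * c * d⁻¹)⁻¹ = d * c⁻¹ * d⁻¹ := by group
    rw [← inv_mem_iff, h2]
    exact all _ (C.inv_mem hc) (by rw [← h2]; exact Left.one_lt_inv_iff.2 h1)
  · rw [h1]; exact C.one_mem
  · exact all c hc h1

/-- An Archimedean left-ordered nilpotent group is abelian: for `a` in the second center and
`e = ⁅a, d⁆`, the element `e ^ (n * n) = ⁅a ^ n, d ^ n⁆` is bounded by a power of `e` that is linear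
in `n`. -/
theorem mul_comm_of_archimedean [Group.IsNilpotent G]
    (arch : ∀ x y : G, 1 < x → ∃ n : ℕ, y ≤ x ^ n) (a b : G) : a * b = b * a := by
  have key : ∀ a d : G, ⁅a, d⁆ ∈ center G → ¬ 1 < ⁅a, d⁆ := by
    intro a d hc hlt
    set e := ⁅a, d⁆ with he
    have hcomm : ∀ x, Commute e x := fun x => (mem_center_iff.1 hc x).symm
    obtain ⟨k, hk⟩ : ∃ k : ℕ, ∀ x ∈ ({a, d, a⁻¹, d⁻¹} : Set G), x ≤ e ^ k := by
      obtain ⟨k₁, h₁⟩ := arch e a hlt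
      obtain ⟨k₂, h₂⟩ := arch e d hlt
      obtain ⟨k₃, h₃⟩ := arch e a⁻¹ hlt
      obtain ⟨k₄, h₄⟩ := arch e d⁻¹ hlt
      refine ⟨k₁ + k₂ + k₃ + k₄, ?_⟩
      rintro x (rfl | rfl | rfl | rfl)
      · exact h₁.trans (pow_le_pow_right' hlt.le (by omega))
      · exact h₂.trans (pow_le_pow_right' hlt.le (by omega))
      · exact h₃.trans (pow_le_pow_right' hlt.le (by omega))
      · exact h₄.trans (pow_le_pow_right' hlt.le (by omega))
    have hmul : ∀ (x y : G) (m l : ℕ), x ≤ e ^ m → y ≤ e ^ l → x * y ≤ e ^ (m + l) := by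
      intro x y m l hx hy
      calc x * y ≤ x * e ^ l := mul_le_mul_right hy x
        _ = e ^ l * x := ((hcomm x).pow_left l).eq.symm
        _ ≤ e ^ l * e ^ m := mul_le_mul_right hx _
        _ = e ^ (m + l) := by rw [← pow_add, add_comm]
    have hpow : ∀ (x : G), x ≤ e ^ k → ∀ n : ℕ, x ^ n ≤ e ^ (n * k) := by
      intro x hx n
      induction n with
      | zero => simp
      | succ n ih => rw [pow_succ, Nat.succ_mul]; exact hmul _ _ _ _ ih hx
    have hn : ∀ n : ℕ, e ^ (n * n) ≤ e ^ (n * k + n * k + n * k + n * k) := by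
      intro n
      have h1 : a * d = e * d * a := by rw [he, commutatorElement_def]; group
      have h2 := pow_mul_pow_eq_of_mul_eq (hcomm a) (hcomm d) h1 n
      have h3 : e ^ (n * n) = a ^ n * d ^ n * a⁻¹ ^ n * d⁻¹ ^ n := by rw [h2]; group
      rw [h3]
      exact hmul _ _ _ _ (hmul _ _ _ _ (hmul _ _ _ _ (hpow a (hk a (by simp)) n)
        (hpow d (hk d (by simp)) n)) (hpow _ (hk _ (by simp)) n)) (hpow _ (hk _ (by simp)) n)
    refine (hn (4 * k + 1)).not_gt (pow_lt_pow_right' hlt ?_)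
    nlinarith
  have eq_one : ∀ a d : G, ⁅a, d⁆ ∈ center G → ⁅a, d⁆ = 1 := by
    intro a d hc
    refine le_antisymm (not_lt.1 (key a d hc)) ?_
    have := key d a (by rw [← commutatorElement_inv]; exact inv_mem hc)
    rw [← commutatorElement_inv] at this
    exact Left.inv_le_one_iff.1 (not_lt.1 this)
  have hle : ∀ n, Subgroup.upperCentralSeries G n ≤ center G := by
    intro n
    induction n with
    | zero => rw [Subgroup.upperCentralSeries_zero]; exact bot_le
    | succ n ih =>
      intro x hx
      refine mem_center_iff.2 fun y => ?_
      exact (commutatorElement_eq_one_iff_commute.1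
        (eq_one x y (ih (commutatorElement_mem_upperCentralSeries_left hx y)))).eq.symm
  obtain ⟨n, hn⟩ := Group.IsNilpotent.nilpotent G
  have hb : b ∈ center G := hle n (hn ▸ mem_top b)
  exact mem_center_iff.1 hb a

end LeftOrderedGroups

/-! ### Constructions and existence of orderings -/

section Orderings

namespace GroupOrdering

variable {G : Type*} [Group G]

theorem lt_iff_one_lt (o : GroupOrdering G) (f g : G) : o.lt f g ↔ o.lt 1 (f⁻¹ * g) := by
  have hne : f ≠ g ↔ (1 : G) ≠ f⁻¹ * g := by rw [ne_eq, ne_eq, eq_comm (a := (1 : G)),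
    inv_mul_eq_one]
  refine and_congr ⟨fun h => ?_, fun h => ?_⟩ hne
  · simpa using o.mul_le_mul_left f⁻¹ _ _ h
  · simpa using o.mul_le_mul_left f _ _ h

theorem one_lt_mul (o : GroupOrdering G) {f g : G} (hf : o.lt 1 f) (hg : o.lt 1 g) :
    o.lt 1 (f * g) := o.positiveCone.mul_mem hf hg

theorem not_one_lt_one (o : GroupOrdering G) : ¬ o.lt 1 1 := fun h => h.2 rfl

theorem one_lt_or_one_lt_inv (o : GroupOrdering G) {g : G} (hg : g ≠ 1) :
    o.lt 1 g ∨ o.lt 1 g⁻¹ := by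
  rcases o.le_total 1 g with h | h
  · exact Or.inl ⟨h, hg.symm⟩
  · exact Or.inr ⟨by simpa using o.mul_le_mul_left g⁻¹ _ _ h, by simpa using hg⟩

theorem not_one_lt_inv (o : GroupOrdering G) {g : G} (hg : o.lt 1 g) : ¬ o.lt 1 g⁻¹ := fun h =>
  o.not_one_lt_one (by simpa using o.one_lt_mul hg h)

theorem eq_of_one_lt_imp {o o' : GroupOrdering G} (h : ∀ g, o.lt 1 g → o'.lt 1 g) : o = o' := by
  have hiff : ∀ g, o.lt 1 g ↔ o'.lt 1 g := by
    refine fun g => ⟨h g, fun hg => ?_⟩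
    have hg1 : g ≠ 1 := by rintro rfl; exact o'.not_one_lt_one hg
    exact (o.one_lt_or_one_lt_inv hg1).resolve_right fun hn => o'.not_one_lt_inv hg (h _ hn)
  have hle : ∀ (o : GroupOrdering G) (f g : G), o.le f g ↔ f = g ∨ o.lt 1 (f⁻¹ * g) := by
    intro o f g
    rw [← lt_iff_one_lt]
    refine ⟨fun hfg => or_iff_not_imp_left.2 fun hne => ⟨hfg, hne⟩, ?_⟩
    rintro (rfl | hlt)
    · exact o.le_refl f
    · exact hlt.1
  ext f g
  rw [hle, hle, hiff]

/-- The left-invariant order with a prescribed set of positive elements. -/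
def ofPos (P : G → Prop) (hone : ¬ P 1) (hmul : ∀ a b, P a → P b → P (a * b))
    (htot : ∀ g, g ≠ 1 → P g ∨ P g⁻¹) : GroupOrdering G where
  le f g := f = g ∨ P (f⁻¹ * g)
  le_refl f := Or.inl rfl
  le_trans := by
    rintro f g h (rfl | h1) (rfl | h2)
    · exact Or.inl rfl
    · exact Or.inr h2
    · exact Or.inr h1
    · exact Or.inr (by simpa [mul_assoc] using hmul _ _ h1 h2)
  le_antisymm := by
    rintro f g (rfl | h1) (h | h2)
    · rfl
    · rfl
    · exact h.symm
    · exact absurd (by simpa [mul_assoc] using hmul _ _ h1 h2) hone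
  le_total f g := by
    by_cases h : f = g
    · exact Or.inl (Or.inl h)
    · rcases htot (f⁻¹ * g) (by rwa [ne_eq, inv_mul_eq_one]) with h1 | h1
      · exact Or.inl (Or.inr h1)
      · exact Or.inr (Or.inr (by simpa using h1))
  mul_le_mul_left f g h := by
    rintro (rfl | h1)
    · exact Or.inl rfl
    · exact Or.inr (by simpa [mul_assoc] using h1)

theorem one_lt_ofPos {P : G → Prop} {hone : ¬ P 1} {hmul : ∀ a b, P a → P b → P (a * b)}
    {htot : ∀ g, g ≠ 1 → P g ∨ P g⁻¹} {g : G} : (ofPos P hone hmul htot).lt 1 g ↔ P g := by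
  constructor
  · rintro ⟨h | h, hne⟩
    · exact absurd h hne
    · simpa using h
  · intro h
    exact ⟨Or.inr (by simpa using h), by rintro rfl; exact hone h⟩

open Classical in
/-- An ordering of a group, as a linear order in the sense of Mathlib. -/
noncomputable abbrev toLinearOrder (o : GroupOrdering G) : LinearOrder G where
  le := o.le
  le_refl := o.le_refl
  le_trans := o.le_trans
  le_antisymm := o.le_antisymm
  le_total := o.le_total
  toDecidableLE := Classical.decRel _

theorem mulLeftMono_toLinearOrder (o : GroupOrdering G) :
    letI := o.toLinearOrder; MulLeftMono G :=
  let _ := o.toLinearOrder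
  ⟨fun f g h hgh => o.mul_le_mul_left f g h hgh⟩

theorem toLinearOrder_lt_iff (o : GroupOrdering G) (f g : G) :
    (letI := o.toLinearOrder; f < g) ↔ o.lt f g := by
  let _ := o.toLinearOrder
  exact lt_iff_le_and_ne

/-- The ordering given by a left-invariant linear order in the sense of Mathlib. -/
def ofLinearOrder (G : Type*) [Group G] [LinearOrder G] [MulLeftMono G] : GroupOrdering G where
  le := (· ≤ ·)
  le_refl := _root_.le_refl
  le_trans _ _ _ := _root_.le_trans
  le_antisymm _ _ := _root_.le_antisymm
  le_total := _root_.le_total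
  mul_le_mul_left f _ _ h := mul_le_mul_right h f

theorem ofLinearOrder_lt_iff [LinearOrder G] [MulLeftMono G] {f g : G} :
    (ofLinearOrder G).lt f g ↔ f < g := lt_iff_le_and_ne.symm

/-- The lexicographic order on a group extension: elements of the normal subgroup are compared
there, all others are compared in the quotient. -/
def ofNormal (N : Subgroup G) [N.Normal] (oN : GroupOrdering N) (oQ : GroupOrdering (G ⧸ N)) :
    GroupOrdering G :=
  ofPos (fun g => (∃ h : g ∈ N, oN.lt 1 ⟨g, h⟩) ∨ oQ.lt 1 (g : G ⧸ N))
    (by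
      rintro (⟨_, h⟩ | h)
      · exact oN.not_one_lt_one h
      · exact oQ.not_one_lt_one h)
    (by
      rintro a b (⟨ha, ha'⟩ | ha) (⟨hb, hb'⟩ | hb)
      · exact Or.inl ⟨N.mul_mem ha hb, oN.one_lt_mul ha' hb'⟩
      · right
        rwa [QuotientGroup.mk_mul, (QuotientGroup.eq_one_iff a).2 ha, one_mul]
      · right
        rwa [QuotientGroup.mk_mul, (QuotientGroup.eq_one_iff b).2 hb, mul_one]
      · right
        rw [QuotientGroup.mk_mul]
        exact oQ.one_lt_mul ha hb)
    (by
      intro g hg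
      by_cases hgN : g ∈ N
      · rcases oN.one_lt_or_one_lt_inv (g := ⟨g, hgN⟩) (by simpa [Subtype.ext_iff] using hg)
          with h | h
        · exact Or.inl (Or.inl ⟨hgN, h⟩)
        · exact Or.inr (Or.inl ⟨N.inv_mem hgN, h⟩)
      · rcases oQ.one_lt_or_one_lt_inv (g := (g : G ⧸ N))
          (by rwa [ne_eq, QuotientGroup.eq_one_iff]) with h | h
        · exact Or.inl (Or.inr h)
        · exact Or.inr (Or.inr h))

theorem one_lt_ofNormal {N : Subgroup G} [N.Normal] {oN : GroupOrdering N}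
    {oQ : GroupOrdering (G ⧸ N)} {g : G} :
    (ofNormal N oN oQ).lt 1 g ↔ (∃ h : g ∈ N, oN.lt 1 ⟨g, h⟩) ∨ oQ.lt 1 (g : G ⧸ N) :=
  one_lt_ofPos

/-- Every submonoid of a torsion-free abelian group that contains no pair of inverse elements
other than `1` is non-negative for some ordering: a maximal such submonoid is the set of
non-negative elements of an ordering. -/
theorem exists_one_lt_of_submonoid {A : Type*} [CommGroup A]
    (tf : ∀ g : A, g ≠ 1 → ¬ IsOfFinOrder g) (M₀ : Submonoid A)
    (hM₀ : ∀ x ∈ M₀, x⁻¹ ∈ M₀ → x = 1) :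
    ∃ o : GroupOrdering A, ∀ x ∈ M₀, x ≠ 1 → o.lt 1 x := by
  obtain ⟨M, hM₀M, hM⟩ := zorn_le_nonempty₀ {M : Submonoid A | ∀ x ∈ M, x⁻¹ ∈ M → x = 1}
    (by
      intro c hc hchain y hy
      have hmem : ∀ x, x ∈ sSup c ↔ ∃ s ∈ c, x ∈ s := fun x =>
        Submonoid.mem_sSup_of_directedOn ⟨y, hy⟩ hchain.directedOn
      refine ⟨sSup c, fun x hx hx' => ?_, fun z hz => le_sSup hz⟩
      obtain ⟨s, hs, hxs⟩ := (hmem x).1 hx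
      obtain ⟨t, ht, hxt⟩ := (hmem x⁻¹).1 hx'
      rcases hchain.total hs ht with h | h
      · exact hc ht x (h hxs) hxt
      · exact hc hs x hxs (h hxt)) M₀ hM₀
  have hMs : ∀ x ∈ M, x⁻¹ ∈ M → x = 1 := hM.prop
  have hpow : ∀ g : A, g ∉ M → ∃ n : ℕ, n ≠ 0 ∧ (g ^ n)⁻¹ ∈ M := by
    intro g hg
    by_contra! hn
    refine hg (hM.le_of_ge (y := M ⊔ Submonoid.powers g) ?_ le_sup_left
      (le_sup_right (a := M) (Submonoid.mem_powers g)))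
    intro x hx hx'
    obtain ⟨m, hm, _, ⟨k, rfl⟩, rfl⟩ := Submonoid.mem_sup.1 hx
    obtain ⟨m', hm', _, ⟨k', rfl⟩, h⟩ := Submonoid.mem_sup.1 hx'
    simp only at h ⊢
    have h1 : m * m' = (g ^ (k + k'))⁻¹ := by
      rw [eq_inv_iff_mul_eq_one, pow_add]
      calc m * m' * (g ^ k * g ^ k') = (m * g ^ k) * (m' * g ^ k') := by
            rw [mul_mul_mul_comm]
        _ = 1 := by rw [h, mul_inv_cancel]
    have h2 : k + k' = 0 := by
      by_contra h0
      exact hn _ h0 (h1 ▸ M.mul_mem hm hm')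
    obtain ⟨rfl, rfl⟩ := Nat.add_eq_zero_iff.1 h2
    have h3 : m' = m⁻¹ := by simpa using h
    rw [hMs m hm (h3 ▸ hm'), pow_zero, one_mul]
  refine ⟨ofPos (fun g => g ∈ M ∧ g ≠ 1) (fun h => h.2 rfl) ?_ ?_, fun x hx hx1 =>
    one_lt_ofPos.2 ⟨hM₀M hx, hx1⟩⟩
  · rintro a b ⟨ha, ha1⟩ ⟨hb, -⟩
    refine ⟨M.mul_mem ha hb, fun h => ha1 (hMs a ha ?_)⟩
    rwa [← eq_inv_of_mul_eq_one_right h]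
  · intro g hg1
    by_cases hg : g ∈ M
    · exact Or.inl ⟨hg, hg1⟩
    · refine Or.inr ⟨?_, inv_ne_one.2 hg1⟩
      by_contra hg'
      obtain ⟨n, hn, h1⟩ := hpow g hg
      obtain ⟨m, hm, h2⟩ := hpow g⁻¹ hg'
      have h3 : (g ^ n) ^ m = 1 := by
        refine hMs _ ?_ ?_
        · rw [← pow_mul, mul_comm, pow_mul]
          simpa using M.pow_mem h2 n
        · rw [← inv_pow]
          exact M.pow_mem h1 m
      rw [← pow_mul] at h3
      exact tf g hg1 (isOfFinOrder_iff_pow_eq_one.2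
        ⟨n * m, Nat.pos_of_ne_zero (mul_ne_zero hn hm), h3⟩)

/-- The center and the quotient by the center of a torsion-free nilpotent group are torsion-free, so
orderings exist by induction on the nilpotency class. -/
theorem nonempty_of_torsionFree (G : Type*) [Group G] [Group.IsNilpotent G]
    (tf : ∀ g : G, g ≠ 1 → ¬ IsOfFinOrder g) : Nonempty (GroupOrdering G) := by
  refine Group.nilpotent_center_quotient_ind
    (P := fun G _ _ => (∀ g : G, g ≠ 1 → ¬ IsOfFinOrder g) → Nonempty (GroupOrdering G))
    G ?_ ?_ tf
  · intro G _ _ _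
    exact ⟨ofPos (fun _ => False) id (fun _ _ h => h.elim)
      fun g hg => (hg (Subsingleton.elim g 1)).elim⟩
  · intro G _ _ ih tf
    obtain ⟨oQ⟩ := ih (torsionFree_quotient_center tf)
    let _ : CommGroup (center G) :=
      { (inferInstance : Group (center G)) with
        mul_comm := fun a b => Subtype.ext (mem_center_iff.1 b.2 a) }
    have tfN : ∀ g : center G, g ≠ 1 → ¬ IsOfFinOrder g := fun g hg h =>
      tf g (fun h1 => hg (Subtype.ext h1)) (Submonoid.isOfFinOrder_coe.2 h)
    obtain ⟨oN, -⟩ := exists_one_lt_of_submonoid tfN ⊥ (fun x hx _ => Submonoid.mem_bot.1 hx)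
    exact ⟨ofNormal (center G) oN oQ⟩

end GroupOrdering

end Orderings

/-! ### Groups of rank one -/

/-- A subgroup has rank at most one if every element of it has a nontrivial power in one fixed
cyclic subgroup of it. -/
def Subgroup.RankLeOne {G : Type*} [Group G] (C : Subgroup G) : Prop :=
  ∃ f ∈ C, ∀ g ∈ C, ∃ n : ℕ, n ≠ 0 ∧ ∃ m : ℤ, g ^ n = f ^ m

/-- A nilpotent action on a torsion-free group of rank one is trivial, so a torsion-free nilpotent
extension of a rank-one group by a rank-one group is abelian. -/
theorem mul_comm_of_rankLeOne {H : Type*} [Group H] [Group.IsNilpotent H]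
    (tf : ∀ g : H, g ≠ 1 → ¬ IsOfFinOrder g) {N : Subgroup H} (hN : N.Normal)
    (hNr : N.RankLeOne)
    (hQ : ∃ f : H, ∀ g : H, ∃ n : ℕ, n ≠ 0 ∧ ∃ m : ℤ, g ^ n * (f ^ m)⁻¹ ∈ N) (a b : H) :
    a * b = b * a := by
  have hNc : N ≤ center H := by
    rcases eq_or_ne N ⊥ with rfl | hne
    · exact bot_le
    obtain ⟨z, hzN, hzc, hz1⟩ := exists_mem_center_of_normal hN hne
    obtain ⟨f, hf, hfr⟩ := hNr
    -- A power of `f` is a power of the central element `z`, hence `f` is central.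
    have hfc : f ∈ center H := by
      obtain ⟨n, hn, m, hm⟩ := hfr z hzN
      have hm0 : m ≠ 0 := by
        rintro rfl
        exact tf z hz1 (isOfFinOrder_iff_pow_eq_one.2
          ⟨n, Nat.pos_of_ne_zero hn, by simpa using hm⟩)
      refine mem_center_of_pow_mem_center tf (Int.natAbs_ne_zero.2 hm0) ?_
      have h1 : f ^ m ∈ center H := hm ▸ Subgroup.pow_mem _ hzc n
      rcases Int.natAbs_eq m with h | h
      · rw [h, zpow_natCast] at h1; exact h1
      · rw [h, zpow_neg, zpow_natCast, inv_mem_iff] at h1; exact h1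
    intro c hc
    obtain ⟨n, hn, m, hm⟩ := hfr c hc
    exact mem_center_of_pow_mem_center tf hn (hm ▸ Subgroup.zpow_mem _ hfc m)
  obtain ⟨f, hf⟩ := hQ
  have hfc : f ∈ center H := by
    refine mem_center_iff.2 fun g => ?_
    obtain ⟨n, hn, m, hm⟩ := hf g
    refine (commute_of_commute_pow tf hn ?_ : Commute g f).eq
    have h1 : Commute (g ^ n * (f ^ m)⁻¹) f := (mem_center_iff.1 (hNc hm) f).symm
    have h2 : Commute (f ^ m) f := (Commute.refl f).zpow_left m
    simpa using h1.mul_left h2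
  have hac : b ∈ center H := by
    obtain ⟨n, hn, m, hm⟩ := hf b
    refine mem_center_of_pow_mem_center tf hn ?_
    simpa using (center H).mul_mem (hNc hm) ((center H).zpow_mem hfc m)
  exact mem_center_iff.1 hac a

/-! ### Orders determined by finitely many positive elements -/

section Determined

variable {G : Type*} [Group G] [LinearOrder G]

/-- The order of a left-ordered group is determined by a set `F` if `F` is a finite set of positive
elements and no other left-invariant order makes all elements of `F` positive. -/
def IsDeterminedBy (F : Set G) : Prop :=
  F.Finite ∧ (∀ f ∈ F, 1 < f) ∧
    ∀ o : GroupOrdering G, (∀ f ∈ F, o.lt 1 f) → ∀ g, 1 < g → o.lt 1 g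

variable [MulLeftMono G]

instance Subgroup.mulLeftMono_coe (D : Subgroup G) : MulLeftMono D :=
  ⟨fun a _ _ h => mul_le_mul_right (α := G) h a⟩

theorem IsDeterminedBy.nonempty [Nontrivial G] {F : Set G} (hF : IsDeterminedBy F) :
    F.Nonempty := by
  rw [Set.nonempty_iff_ne_empty]
  rintro rfl
  let o : GroupOrdering G := GroupOrdering.ofPos (fun g => g < 1) (lt_irrefl 1)
    (fun a b ha hb => Left.mul_lt_one ha hb) fun g hg => by
      simpa using lt_or_gt_of_ne hg
  obtain ⟨g, hg⟩ := exists_ne (1 : G)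
  obtain ⟨x, hx⟩ : ∃ x : G, 1 < x := by
    rcases lt_or_gt_of_ne hg with h | h
    · exact ⟨g⁻¹, Left.one_lt_inv_iff.2 h⟩
    · exact ⟨g, h⟩
  exact hx.not_gt ((GroupOrdering.one_lt_ofPos (P := fun g : G => g < 1)).1
    (hF.2.2 o (by simp) x hx))

/-- The order can be replaced by any other one on a convex subgroup. -/
theorem IsDeterminedBy.subgroup {F : Set G} (hF : IsDeterminedBy F) {D : Subgroup G}
    (hD : (D : Set G).OrdConnected) : IsDeterminedBy (Subtype.val ⁻¹' F : Set D) := by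
  refine ⟨hF.1.preimage Subtype.val_injective.injOn, fun f hf => hF.2.1 f hf, fun o ho g hg => ?_⟩
  let o' : GroupOrdering G := GroupOrdering.ofPos
    (fun g => (∃ h : g ∈ D, o.lt 1 ⟨g, h⟩) ∨ (g ∉ D ∧ 1 < g))
    (by
      rintro (⟨_, h⟩ | h)
      · exact o.not_one_lt_one h
      · exact h.1 D.one_mem)
    (by
      rintro a b (⟨ha, ha'⟩ | ⟨ha, ha'⟩) (⟨hb, hb'⟩ | ⟨hb, hb'⟩)
      · exact Or.inl ⟨D.mul_mem ha hb, o.one_lt_mul ha' hb'⟩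
      · refine Or.inr ⟨fun h => hb ((D.mul_mem_cancel_left ha).1 h), ?_⟩
        by_contra! h
        have h1 : b ≤ a⁻¹ := by simpa using mul_le_mul_right h a⁻¹
        exact hb (Subgroup.mem_of_one_lt_of_le hD hb' h1 (D.inv_mem ha))
      · refine Or.inr ⟨fun h => ha ((D.mul_mem_cancel_right hb).1 h), ?_⟩
        by_contra! h
        have h1 : b ≤ a⁻¹ := by simpa using mul_le_mul_right h a⁻¹
        exact ha (inv_mem_iff.1 (hD.out hb D.one_mem ⟨h1, (Left.inv_lt_one_iff.2 ha').le⟩))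
      · have h1 : a < a * b := lt_mul_of_one_lt_right' a hb'
        exact Or.inr ⟨fun h => ha (Subgroup.mem_of_one_lt_of_le hD ha' h1.le h), ha'.trans h1⟩)
    (by
      intro g hg
      by_cases hgD : g ∈ D
      · rcases o.one_lt_or_one_lt_inv (g := ⟨g, hgD⟩) (by simpa [Subtype.ext_iff] using hg)
          with h | h
        · exact Or.inl (Or.inl ⟨hgD, h⟩)
        · exact Or.inr (Or.inl ⟨D.inv_mem hgD, h⟩)
      · rcases lt_or_gt_of_ne hg with h | h
        · exact Or.inr (Or.inr ⟨by simpa using hgD, Left.one_lt_inv_iff.2 h⟩)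
        · exact Or.inl (Or.inr ⟨hgD, h⟩))
  have h1 := hF.2.2 o' (fun f hf => GroupOrdering.one_lt_ofPos.2 ?_) g hg
  · rcases GroupOrdering.one_lt_ofPos.1 h1 with ⟨_, h⟩ | h
    · exact h
    · exact absurd g.2 h.1
  · by_cases hfD : f ∈ D
    · exact Or.inl ⟨hfD, ho ⟨f, hfD⟩ hf⟩
    · exact Or.inr ⟨hfD, hF.2.1 f hf⟩

/-- The quotient of a left-ordered group by a convex normal subgroup is left-ordered. -/
theorem exists_linearOrder_quotient (N : Subgroup G) [N.Normal]
    (hN : (N : Set G).OrdConnected) : ∃ _ : LinearOrder (G ⧸ N), MulLeftMono (G ⧸ N) ∧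
      ∀ g : G, 1 < (g : G ⧸ N) ↔ 1 < g ∧ g ∉ N := by
  let o : GroupOrdering (G ⧸ N) := GroupOrdering.ofPos
    (fun q => ∃ g : G, (g : G ⧸ N) = q ∧ 1 < g ∧ g ∉ N)
    (by
      rintro ⟨g, hg, -, hgN⟩
      exact hgN ((QuotientGroup.eq_one_iff g).1 hg))
    (by
      rintro _ _ ⟨a, rfl, ha, haN⟩ ⟨b, rfl, hb, -⟩
      have h1 : a < a * b := lt_mul_of_one_lt_right' a hb
      exact ⟨a * b, rfl, ha.trans h1,
        fun h => haN (Subgroup.mem_of_one_lt_of_le hN ha h1.le h)⟩)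
    (by
      intro q hq
      obtain ⟨g, rfl⟩ := QuotientGroup.mk_surjective q
      have hgN : g ∉ N := fun h => hq ((QuotientGroup.eq_one_iff g).2 h)
      have hg1 : g ≠ 1 := by rintro rfl; exact hgN N.one_mem
      rcases lt_or_gt_of_ne hg1 with h | h
      · exact Or.inr ⟨g⁻¹, rfl, Left.one_lt_inv_iff.2 h, by simpa using hgN⟩
      · exact Or.inl ⟨g, rfl, h, hgN⟩)
  refine ⟨o.toLinearOrder, o.mulLeftMono_toLinearOrder, fun g => ?_⟩
  refine (o.toLinearOrder_lt_iff 1 g).trans (GroupOrdering.one_lt_ofPos.trans ⟨?_, ?_⟩)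
  · rintro ⟨a, hag, ha, haN⟩
    have h1 : a⁻¹ * g ∈ N := QuotientGroup.eq.1 hag
    have hgN : g ∉ N := fun h => haN (by simpa using N.mul_mem h (N.inv_mem h1))
    refine ⟨?_, hgN⟩
    by_contra! hle
    have h2 : g⁻¹ * a ∈ N := by simpa using N.inv_mem h1
    refine hgN (inv_mem_iff.1 (hN.out N.one_mem h2 ⟨Left.one_le_inv_iff.2 hle, ?_⟩))
    exact (lt_mul_of_one_lt_right' g⁻¹ ha).le
  · rintro ⟨h1, hgN⟩
    exact ⟨g, rfl, h1, hgN⟩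

/-- The order can be replaced by any other one on the quotient by a convex normal subgroup. -/
theorem IsDeterminedBy.quotient {F : Set G} (hF : IsDeterminedBy F) {N : Subgroup G} [N.Normal]
    [LinearOrder (G ⧸ N)] (hq : ∀ g : G, 1 < (g : G ⧸ N) ↔ 1 < g ∧ g ∉ N) :
    IsDeterminedBy ((fun g : G => (g : G ⧸ N)) '' (F \ N)) := by
  refine ⟨(hF.1.sdiff).image _, ?_, fun o ho q hq1 => ?_⟩
  · rintro _ ⟨f, hf, rfl⟩
    exact (hq f).2 ⟨hF.2.1 f hf.1, hf.2⟩
  obtain ⟨g, rfl⟩ := QuotientGroup.mk_surjective q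
  obtain ⟨hg, hgN⟩ := (hq g).1 hq1
  have h1 := hF.2.2 (GroupOrdering.ofNormal N (GroupOrdering.ofLinearOrder N) o)
    (fun f hf => GroupOrdering.one_lt_ofNormal.2 ?_) g hg
  · rcases GroupOrdering.one_lt_ofNormal.1 h1 with ⟨h, -⟩ | h
    · exact absurd h hgN
    · exact h
  · by_cases hfN : f ∈ N
    · exact Or.inl ⟨hfN, GroupOrdering.ofLinearOrder_lt_iff.2 (hF.2.1 f hf)⟩
    · exact Or.inr (ho _ ⟨f, ⟨hf, hfN⟩, rfl⟩)

end Determined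

/-! ### Determined orders on abelian groups -/

section Abelian

variable {A : Type*} [CommGroup A] [LinearOrder A] [MulLeftMono A]

/-- Otherwise `F` together with `g⁻¹` would be positive for some ordering. -/
theorem IsDeterminedBy.exists_pow_mem_closure {F : Set A} (hF : IsDeterminedBy F) {g : A}
    (hg : 1 < g) : ∃ n : ℕ, n ≠ 0 ∧ g ^ n ∈ Submonoid.closure F := by
  by_contra! hn
  have hpos : ∀ x ∈ Submonoid.closure F, 1 ≤ x := fun x hx =>
    Submonoid.closure_le (S := Submonoid.oneLE A).2 (fun f hf => (hF.2.1 f hf).le) hx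
  obtain ⟨o, ho⟩ := GroupOrdering.exists_one_lt_of_submonoid not_isOfFinOrder_of_leftOrdered
    (Submonoid.closure F ⊔ Submonoid.powers g⁻¹) (by
      intro x hx hx'
      obtain ⟨m, hm, _, ⟨k, rfl⟩, rfl⟩ := Submonoid.mem_sup.1 hx
      obtain ⟨m', hm', _, ⟨k', rfl⟩, h⟩ := Submonoid.mem_sup.1 hx'
      simp only at h ⊢
      have h1 : m * m' = g ^ (k + k') := by
        rw [pow_add, ← mul_inv_eq_one]
        calc m * m' * (g ^ k * g ^ k')⁻¹ = (m * g⁻¹ ^ k) * (m' * g⁻¹ ^ k') := by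
              rw [mul_mul_mul_comm, mul_inv, inv_pow, inv_pow]
          _ = 1 := by rw [h, mul_inv_cancel]
      have h2 : k + k' = 0 := by
        by_contra h0
        exact hn _ h0 (h1 ▸ Submonoid.mul_mem _ hm hm')
      rw [h2, pow_zero] at h1
      have h3 : m = 1 := le_antisymm (by
        rw [← h1]; exact le_mul_of_one_le_right' (hpos m' hm')) (hpos m hm)
      simp [h3, (Nat.add_eq_zero_iff.1 h2).1])
  have h1 : o.lt 1 g := hF.2.2 o (fun f hf => ho f
    (le_sup_left (a := Submonoid.closure F) (Submonoid.subset_closure hf)) (hF.2.1 f hf).ne') g hg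
  exact o.not_one_lt_inv h1 (ho g⁻¹ (le_sup_right (a := Submonoid.closure F)
    (Submonoid.mem_powers g⁻¹)) (inv_ne_one.2 hg.ne'))

/-- If `f < f'` are two of finitely many positive elements generating, up to roots, all positive
elements, then a power of `f⁻¹ * f'` is a product of these elements, and this relation expresses a
power of `f'` through the other elements. So `f'` can be dropped, and eventually one element
remains. -/
theorem exists_pow_mem_powers_of_closure [Nontrivial A] {F : Finset A} (hF : ∀ f ∈ F, 1 < f)
    (h : ∀ g : A, 1 < g → ∃ n : ℕ, n ≠ 0 ∧ g ^ n ∈ Submonoid.closure (F : Set A)) :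
    ∃ f : A, ∀ g : A, 1 < g → ∃ n : ℕ, n ≠ 0 ∧ g ^ n ∈ Submonoid.powers f := by
  classical
  induction hk : F.card generalizing F with
  | zero =>
    rw [Finset.card_eq_zero] at hk
    subst hk
    exact ⟨1, by simpa [Submonoid.powers_one] using h⟩
  | succ k ih =>
    by_cases hk1 : ∃ f ∈ F, ∃ f' ∈ F, f < f'
    · obtain ⟨f, hf, f', hf', hlt⟩ := hk1
      set M := Submonoid.closure ((F.erase f' : Finset A) : Set A) with hM
      have hsplit : ∀ x ∈ Submonoid.closure (F : Set A), ∃ s ∈ M, ∃ a : ℕ, x = s * f' ^ a := by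
        intro x hx
        rw [← Finset.insert_erase hf', Finset.coe_insert, ← Set.union_singleton,
          Submonoid.closure_union] at hx
        obtain ⟨s, hs, y, hy, rfl⟩ := Submonoid.mem_sup.1 hx
        obtain ⟨a, rfl⟩ := Submonoid.mem_closure_singleton.1 hy
        exact ⟨s, hs, a, rfl⟩
      have hMpos : ∀ x ∈ M, 1 ≤ x := fun x hx =>
        Submonoid.closure_le (S := Submonoid.oneLE A).2
          (fun f hf => (hF f (Finset.mem_of_mem_erase hf)).le) hx
      have hfM : f ∈ M := Submonoid.subset_closure (by simp [hf, hlt.ne])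
      obtain ⟨n, hn, hn'⟩ := h (f⁻¹ * f') (lt_inv_mul_iff_lt.2 hlt)
      obtain ⟨s, hs, a, hsa⟩ := hsplit _ hn'
      have hrel : f' ^ n = s * f ^ n * f' ^ a := by
        rw [mul_right_comm, ← hsa, mul_pow, inv_pow, mul_comm, mul_inv_cancel_left]
      have han : a < n := by
        by_contra! hle
        have h1 : f' ^ n ≤ f' ^ a := pow_le_pow_right' (hF f' hf').le hle
        have h2 : 1 < s * f ^ n :=
          Left.one_lt_mul_of_le_of_lt (hMpos s hs) (one_lt_pow' (hF f hf) hn)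
        have h3 : f' ^ a < s * f ^ n * f' ^ a := by
          rw [mul_comm]; exact lt_mul_of_one_lt_right' _ h2
        exact (h1.trans_lt h3).ne hrel
      have hroot : f' ^ (n - a) ∈ M := by
        have h1 : f' ^ (n - a) = s * f ^ n := by
          rw [pow_sub _ han.le, hrel, mul_inv_cancel_right]
        rw [h1]
        exact M.mul_mem hs (M.pow_mem hfM n)
      refine ih (F := F.erase f') (fun f hf => hF f (Finset.mem_of_mem_erase hf)) ?_
        (by rw [Finset.card_erase_of_mem hf', hk]; rfl)
      intro g hg
      obtain ⟨j, hj, hgj⟩ := h g hg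
      obtain ⟨t, ht, b, htb⟩ := hsplit _ hgj
      refine ⟨j * (n - a), mul_ne_zero hj (Nat.sub_ne_zero_of_lt han), ?_⟩
      rw [pow_mul, htb, mul_pow, ← pow_mul, mul_comm b, pow_mul]
      exact M.mul_mem (M.pow_mem ht _) (M.pow_mem hroot _)
    · push Not at hk1
      obtain ⟨f, hf⟩ : F.Nonempty := Finset.card_pos.1 (by omega)
      have hFf : (F : Set A) = {f} := by
        ext x
        refine ⟨fun hx => le_antisymm (hk1 f hf x hx) (hk1 x hx f hf), ?_⟩
        rintro rfl
        exact hf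
      refine ⟨f, fun g hg => ?_⟩
      rw [Submonoid.powers_eq_closure, ← hFf]
      exact h g hg

theorem IsDeterminedBy.exists_pow_eq_zpow [Nontrivial A] {F : Set A} (hF : IsDeterminedBy F) :
    ∃ f : A, ∀ g : A, ∃ n : ℕ, n ≠ 0 ∧ ∃ m : ℤ, g ^ n = f ^ m := by
  obtain ⟨f, hf⟩ := exists_pow_mem_powers_of_closure (F := hF.1.toFinset)
    (fun f hf => hF.2.1 f (by simpa using hf))
    (fun g hg => by simpa using hF.exists_pow_mem_closure hg)
  refine ⟨f, fun g => ?_⟩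
  rcases lt_trichotomy g 1 with h | rfl | h
  · obtain ⟨n, hn, m, hm⟩ := hf g⁻¹ (Left.one_lt_inv_iff.2 h)
    refine ⟨n, hn, -m, ?_⟩
    simp only at hm
    rw [zpow_neg, zpow_natCast, hm, inv_pow, inv_inv]
  · exact ⟨1, one_ne_zero, 0, by simp⟩
  · obtain ⟨n, hn, m, hm⟩ := hf g h
    exact ⟨n, hn, m, by simpa using hm.symm⟩

theorem IsDeterminedBy.rankLeOne {G : Type*} [hG : Group G] [LinearOrder G] [MulLeftMono G]
    {F : Set G} (hF : IsDeterminedBy F) {D : Subgroup G} (hD : (D : Set G).OrdConnected)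
    (hne : D ≠ ⊥) (hcomm : ∀ a b : D, a * b = b * a) : D.RankLeOne := by
  have hnt : Nontrivial D := (Subgroup.nontrivial_iff_ne_bot D).2 hne
  have hFD := hF.subgroup hD
  -- A commutative group structure on the same group is substituted for the given one.
  have key : ∀ (A : Type _) [hA : Group A] [LinearOrder A] [MulLeftMono A] [Nontrivial A]
      (F : Set A), IsDeterminedBy F → (∀ a b : A, a * b = b * a) →
      ∃ f : A, ∀ g : A, ∃ n : ℕ, n ≠ 0 ∧ ∃ m : ℤ, g ^ n = f ^ m := by
    intro A hA _ _ _ F hF hcomm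
    obtain ⟨i, rfl⟩ : ∃ i : CommGroup A, hA = i.toGroup := ⟨{ hA with mul_comm := hcomm }, rfl⟩
    exact hF.exists_pow_eq_zpow
  obtain ⟨f, hf⟩ := key D _ hFD hcomm
  refine ⟨f, f.2, fun g hg => ?_⟩
  obtain ⟨n, hn, m, hm⟩ := hf ⟨g, hg⟩
  exact ⟨n, hn, m, by simpa using congrArg Subtype.val hm⟩

end Abelian

/-! ### Determined orders on nilpotent groups -/

section Nilpotent

variable {G : Type*} [Group G] [LinearOrder G] [MulLeftMono G] [Group.IsNilpotent G]

/-- Every nontrivial convex subgroup contains an element of `F`, hence the least element of `F`,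
so there is a least nontrivial convex subgroup. It is Archimedean, hence abelian. -/
theorem IsDeterminedBy.exists_rankLeOne [Nontrivial G] {F : Set G} (hF : IsDeterminedBy F) :
    ∃ C : Subgroup G, (C : Set G).OrdConnected ∧ C ≠ ⊥ ∧ (∀ a b : C, a * b = b * a) ∧
      C.RankLeOne := by
  obtain ⟨f, hf, hfmin⟩ := Set.exists_min_image F id hF.1 hF.nonempty
  have hf1 := hF.2.1 f hf
  have hmem : ∀ D : Subgroup G, (D : Set G).OrdConnected → D ≠ ⊥ → f ∈ D := by
    intro D hD hne
    have : Nontrivial D := (Subgroup.nontrivial_iff_ne_bot D).2 hne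
    obtain ⟨f', hf'⟩ := (hF.subgroup hD).nonempty
    exact Subgroup.mem_of_one_lt_of_le hD hf1 (hfmin f' hf') f'.2
  have hne : leastConvex f ≠ ⊥ := by
    intro h
    have := mem_leastConvex f
    rw [h, mem_bot] at this
    exact hf1.ne' this
  have hcomm : ∀ a b : leastConvex f, a * b = b * a := by
    refine mul_comm_of_archimedean fun x y hx => ?_
    have hx' : (1 : G) < x := hx
    have hfx : f ∈ leastConvex (x : G) := by
      refine hmem _ (ordConnected_leastConvex _) fun h => ?_
      have := mem_leastConvex (x : G)
      rw [h, mem_bot] at this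
      exact hx'.ne' this
    exact exists_le_pow_of_mem_leastConvex (g := (x : G)) (h := (y : G)) hx'
      (leastConvex_le (ordConnected_leastConvex _) hfx y.2)
  exact ⟨leastConvex f, ordConnected_leastConvex f, hne, hcomm,
    hF.rankLeOne (ordConnected_leastConvex f) hne hcomm⟩

/-- In a determined order, a rank-one convex normal subgroup `C` is the whole group. Otherwise
`G ⧸ C` has a rank-one convex subgroup, whose preimage is abelian, convex and, being itself
determined, of rank one; but a convex subgroup is closed under roots. -/
theorem IsDeterminedBy.eq_top_of_normal {F : Set G} (hF : IsDeterminedBy F) {C : Subgroup G}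
    [C.Normal] (hC : (C : Set G).OrdConnected) (hne : C ≠ ⊥) (hCr : C.RankLeOne) : C = ⊤ := by
  by_contra htop
  obtain ⟨_, _, hq⟩ := exists_linearOrder_quotient C hC
  have : Nontrivial (G ⧸ C) := QuotientGroup.nontrivial_iff.2 htop
  obtain ⟨E', hE', hE'ne, -, f', hf'E, hf'⟩ := (hF.quotient hq).exists_rankLeOne
  obtain ⟨f, rfl⟩ := QuotientGroup.mk_surjective f'
  let E : Subgroup G := E'.comap (QuotientGroup.mk' C)
  have hmemE : ∀ g : G, g ∈ E ↔ (g : G ⧸ C) ∈ E' := fun g => Iff.rfl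
  have hCE : C ≤ E := fun c hc => by
    rw [hmemE, (QuotientGroup.eq_one_iff c).2 hc]
    exact E'.one_mem
  have hE : (E : Set G).OrdConnected := by
    refine Subgroup.ordConnected_of_forall fun x y hx hxy hy => ?_
    by_cases hxC : x ∈ C
    · exact hCE hxC
    refine Subgroup.mem_of_one_lt_of_le hE' ((hq x).2 ⟨hx, hxC⟩) ?_ hy
    by_contra! hlt
    have h1 : 1 < ((y⁻¹ * x : G) : G ⧸ C) := lt_inv_mul_iff_lt.2 hlt
    exact (lt_inv_mul_iff_lt.1 ((hq _).1 h1).1).not_ge hxy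
  have hEne : E ≠ ⊥ := fun h => hne (le_bot_iff.1 (h ▸ hCE))
  have hcomm : ∀ a b : E, a * b = b * a := by
    refine mul_comm_of_rankLeOne not_isOfFinOrder_of_leftOrdered (N := C.subgroupOf E)
      inferInstance ?_ ⟨⟨f, hf'E⟩, fun g => ?_⟩
    · obtain ⟨c, hc, hcr⟩ := hCr
      refine ⟨⟨c, hCE hc⟩, hc, fun g hg => ?_⟩
      obtain ⟨n, hn, m, hm⟩ := hcr g hg
      exact ⟨n, hn, m, Subtype.ext (by simpa using hm)⟩
    · obtain ⟨n, hn, m, hm⟩ := hf' g g.2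
      refine ⟨n, hn, m, ?_⟩
      have h1 : (g : G) ^ n * (f ^ m)⁻¹ ∈ C := by
        rw [← QuotientGroup.eq_one_iff, QuotientGroup.mk_mul, QuotientGroup.mk_inv,
          QuotientGroup.mk_pow, QuotientGroup.mk_zpow, hm, mul_inv_cancel]
      simpa [Subgroup.mem_subgroupOf] using h1
  obtain ⟨e, heE, he⟩ := hF.rankLeOne hE hEne hcomm
  have heC : e ∈ C := by
    obtain ⟨c, hc, hc1⟩ := (bot_or_exists_ne_one C).resolve_left hne
    obtain ⟨n, hn, m, hm⟩ := he c (hCE hc)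
    have hm0 : m ≠ 0 := by
      rintro rfl
      exact not_isOfFinOrder_of_leftOrdered c hc1 (isOfFinOrder_iff_pow_eq_one.2
        ⟨n, Nat.pos_of_ne_zero hn, by simpa using hm⟩)
    refine Subgroup.mem_of_pow_mem_of_ordConnected hC (Int.natAbs_ne_zero.2 hm0) ?_
    have h1 : e ^ m ∈ C := hm ▸ C.pow_mem hc n
    rcases Int.natAbs_eq m with h | h
    · rw [h, zpow_natCast] at h1; exact h1
    · rw [h, zpow_neg, zpow_natCast, inv_mem_iff] at h1; exact h1
  obtain ⟨q, hqE, hq1⟩ := (bot_or_exists_ne_one E').resolve_left hE'ne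
  obtain ⟨g, rfl⟩ := QuotientGroup.mk_surjective q
  refine hq1 ((QuotientGroup.eq_one_iff g).2 ?_)
  obtain ⟨n, hn, m, hm⟩ := he g hqE
  exact Subgroup.mem_of_pow_mem_of_ordConnected hC hn (hm ▸ C.zpow_mem heC m)

theorem normal_greatestConvexOmitting_subgroupOf {g : G} (hg : 1 < g) :
    ((greatestConvexOmitting g).subgroupOf (leastConvex g)).Normal :=
  ⟨fun _ hc d => conj_mem_greatestConvexOmitting hg hc d.2⟩

/-- The order can be replaced by any other one on the quotient of `leastConvex g` by
`greatestConvexOmitting g`, so `F` has to intervene there. -/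
theorem IsDeterminedBy.exists_mem_leastConvex {F : Set G} (hF : IsDeterminedBy F) {g : G}
    (hg : 1 < g) : ∃ f ∈ F, f ∈ leastConvex g ∧ f ∉ greatestConvexOmitting g := by
  have := normal_greatestConvexOmitting_subgroupOf hg
  obtain ⟨_, _, hq⟩ := exists_linearOrder_quotient
    ((greatestConvexOmitting g).subgroupOf (leastConvex g))
    (ordConnected_subgroupOf (ordConnected_greatestConvexOmitting hg.ne'))
  have : Nontrivial (leastConvex g ⧸ (greatestConvexOmitting g).subgroupOf (leastConvex g)) := by
    refine QuotientGroup.nontrivial_iff.2 fun h => notMem_greatestConvexOmitting hg.ne' ?_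
    exact Subgroup.subgroupOf_eq_top.1 h (mem_leastConvex g)
  obtain ⟨_, f, hf, -⟩ := ((hF.subgroup (ordConnected_leastConvex g)).quotient hq).nonempty
  exact ⟨f, hf.1, f.2, hf.2⟩

/-- A left-ordered nilpotent group whose order is determined by finitely many positive elements is
abelian of rank one. If the least nontrivial convex subgroup `C` is proper, then some convex
subgroup is minimal among those properly containing `C`, and `C` is normal in it. -/
theorem IsDeterminedBy.mul_comm_and_rankLeOne_top [Nontrivial G] {F : Set G}
    (hF : IsDeterminedBy F) : (∀ a b : G, a * b = b * a) ∧ (⊤ : Subgroup G).RankLeOne := by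
  obtain ⟨C, hC, hne, hcomm, hCr⟩ := hF.exists_rankLeOne
  by_cases htop : C = ⊤
  · subst htop
    exact ⟨fun a b => congrArg Subtype.val (hcomm ⟨a, mem_top a⟩ ⟨b, mem_top b⟩), hCr⟩
  exfalso
  have hit : ∀ x, 1 < x → x ∉ C → ∃ f ∈ F \ C, f ∈ leastConvex x := by
    intro x hx hxC
    obtain ⟨f, hf, hfx, hfK⟩ := hF.exists_mem_leastConvex hx
    exact ⟨f, ⟨hf, fun h => hfK (le_greatestConvexOmitting hC hxC h)⟩, hfx⟩
  obtain ⟨x, hx, -, hxC⟩ := Subgroup.exists_one_lt_mem_notMem (fun h => htop (top_le_iff.1 h))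
  obtain ⟨f, hf, -⟩ := hit x hx hxC
  obtain ⟨g, hg, hgmin⟩ := Set.exists_min_image (F \ C) id hF.1.sdiff ⟨f, hf⟩
  have hg1 := hF.2.1 g hg.1
  have hKC : greatestConvexOmitting g = C := by
    refine le_antisymm ?_ (le_greatestConvexOmitting hC hg.2)
    by_contra hnle
    obtain ⟨y, hy, hyK, hyC⟩ := Subgroup.exists_one_lt_mem_notMem hnle
    obtain ⟨f', hf', hf'y⟩ := hit y hy hyC
    have hK := ordConnected_greatestConvexOmitting hg1.ne'
    exact notMem_greatestConvexOmitting hg1.ne'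
      (Subgroup.mem_of_one_lt_of_le hK hg1 (hgmin f' hf') (leastConvex_le hK hyK hf'y))
  have hle : C ≤ leastConvex g := hKC ▸ greatestConvexOmitting_le_leastConvex hg1.ne'
  have : (C.subgroupOf (leastConvex g)).Normal := by
    rw [← hKC]
    exact normal_greatestConvexOmitting_subgroupOf hg1
  have heq := (hF.subgroup (ordConnected_leastConvex g)).eq_top_of_normal
    (C := C.subgroupOf (leastConvex g)) (ordConnected_subgroupOf hC)
    (by
      intro h
      rw [Subgroup.subgroupOf_eq_bot] at h
      exact hne (le_bot_iff.1 (h le_rfl hle)))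
    (by
      obtain ⟨c, hc, hcr⟩ := hCr
      refine ⟨⟨c, hle hc⟩, hc, fun g hg => ?_⟩
      obtain ⟨n, hn, m, hm⟩ := hcr g hg
      exact ⟨n, hn, m, Subtype.ext (by simpa using hm)⟩)
  exact hg.2 (Subgroup.subgroupOf_eq_top.1 heq (mem_leastConvex g))

end Nilpotent

/-! ### The topology of the space of orderings -/

section Topology

open Filter Topology

namespace GroupOrdering

variable {G : Type*} [Group G]

theorem isOpen_setOf_lt (f g : G) : IsOpen {o : GroupOrdering G | o.lt f g} :=
  TopologicalSpace.isOpen_generateFrom_of_mem ⟨f, g, rfl⟩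

theorem isClopen_setOf_one_lt (g : G) : IsClopen {o : GroupOrdering G | o.lt 1 g} := by
  refine ⟨⟨?_⟩, isOpen_setOf_lt 1 g⟩
  by_cases hg : g = 1
  · subst hg
    convert! isOpen_univ
    exact Set.eq_univ_of_forall fun o => o.not_one_lt_one
  · convert! isOpen_setOf_lt 1 g⁻¹ using 1
    ext o
    exact ⟨(o.one_lt_or_one_lt_inv hg).resolve_left, fun h h' => o.not_one_lt_inv h' h⟩

/-- The limit of an ultrafilter of orderings is the relation that holds for almost all of them. -/
instance : CompactSpace (GroupOrdering G) := by
  refine ⟨isCompact_iff_ultrafilter_le_nhds.2 fun 𝒰 _ => ?_⟩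
  let o : GroupOrdering G :=
    { le := fun f g => ∀ᶠ o in 𝒰, GroupOrdering.le o f g
      le_refl := fun f => Eventually.of_forall fun o => o.le_refl f
      le_trans := fun f g h h1 h2 => by
        filter_upwards [h1, h2] with o h1 h2 using o.le_trans f g h h1 h2
      le_antisymm := fun f g h1 h2 => by
        obtain ⟨o, h1, h2⟩ := (h1.and h2).exists
        exact o.le_antisymm f g h1 h2
      le_total := fun f g =>
        Ultrafilter.eventually_or.1 (Eventually.of_forall fun o => o.le_total f g)
      mul_le_mul_left := fun f g h h1 => by
        filter_upwards [h1] with o h1 using o.mul_le_mul_left f g h h1 }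
  refine ⟨o, Set.mem_univ o, ?_⟩
  rw [TopologicalSpace.nhds_generateFrom]
  refine le_iInf₂ fun U hU => ?_
  obtain ⟨ho, f, g, rfl⟩ := hU
  rw [le_principal_iff]
  filter_upwards [ho.1] with o' ho' using ⟨ho', ho.2⟩

/-- An isolated point of the space of orderings is determined by finitely many positive
elements. -/
theorem exists_isDeterminedBy_of_isOpen_singleton {o : GroupOrdering G}
    (ho : IsOpen ({o} : Set (GroupOrdering G))) :
    letI := o.toLinearOrder; ∃ F : Set G, IsDeterminedBy F := by
  obtain ⟨_, ⟨T, ⟨hTfin, hT⟩, rfl⟩, hoT, hTo⟩ :=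
    (TopologicalSpace.isTopologicalBasis_of_subbasis (α := GroupOrdering G)
      rfl).exists_subset_of_mem_open (Set.mem_singleton o) ho
  have hT' : ∀ U ∈ T, ∃ f g : G, U = {o : GroupOrdering G | o.lt f g} := fun U hU => hT hU
  choose! f g hfg using hT'
  refine ⟨(fun U => (f U)⁻¹ * g U) '' T, hTfin.image _, ?_, fun o' ho' x hx => ?_⟩
  · rintro _ ⟨U, hU, rfl⟩
    have h1 := hoT U hU
    rw [hfg U hU] at h1
    exact (o.toLinearOrder_lt_iff _ _).2 ((o.lt_iff_one_lt _ _).1 h1)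
  · have h1 : o' = o := hTo fun U hU => by
      rw [hfg U hU]
      exact (o'.lt_iff_one_lt _ _).2 (ho' _ ⟨U, hU, rfl⟩)
    rw [h1]
    exact (o.toLinearOrder_lt_iff _ _).1 hx

/-- If the positive cone is generated by `S`, then every ordering making `S` positive has the same
positive cone. -/
theorem isOpen_singleton_of_closure_eq {o : GroupOrdering G} {S : Set G} (hS : S.Finite)
    (h : Subsemigroup.closure S = o.positiveCone) : IsOpen ({o} : Set (GroupOrdering G)) := by
  have h1 : ({o} : Set (GroupOrdering G)) = ⋂ s ∈ S, {o' : GroupOrdering G | o'.lt 1 s} := by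
    ext o'
    simp only [Set.mem_singleton_iff, Set.mem_iInter, Set.mem_ofPred_eq]
    constructor
    · rintro rfl s hs
      have : s ∈ o'.positiveCone := h ▸ Subsemigroup.subset_closure hs
      exact this
    · intro hs
      have hle : o.positiveCone ≤ o'.positiveCone := h ▸ Subsemigroup.closure_le.2 hs
      exact (eq_of_one_lt_imp fun g hg => hle hg).symm
  rw [h1]
  exact hS.isOpen_biInter fun s _ => isOpen_setOf_lt 1 s

end GroupOrdering

/-! ### Brouwer's characterization of the Cantor set -/

namespace BinarySplitting

variable {X : Type*} (U : ℕ → Set X)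

/-- The set `V` meets both `W` and its complement. -/
def Splits (W V : Set X) : Prop := (W ∩ V).Nonempty ∧ (W \ V).Nonempty

open Classical in
/-- The first set of the sequence `U` that splits `W` (and the empty set if there is none). -/
noncomputable def splitter (W : Set X) : Set X :=
  if h : ∃ n, Splits W (U n) then U (Nat.find h) else ∅

open Classical in
/-- The cell with address `s 0, …, s (k - 1)`: starting with the whole space, each cell is cut in
two by its splitter, and the next digit of the address selects one of the two parts. -/
noncomputable def cell (s : ℕ → Bool) : ℕ → Set X
  | 0 => Set.univ
  | k + 1 => if s k then cell s k ∩ splitter U (cell s k) else cell s k \ splitter U (cell s k)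

open Classical in
/-- The cell of depth `k` containing the point `x`. -/
noncomputable def cellOf (x : X) : ℕ → Set X
  | 0 => Set.univ
  | k + 1 => if x ∈ splitter U (cellOf x k) then cellOf x k ∩ splitter U (cellOf x k)
      else cellOf x k \ splitter U (cellOf x k)

open Classical in
/-- The infinite address of a point. -/
noncomputable def code (x : X) (k : ℕ) : Bool := decide (x ∈ splitter U (cellOf U x k))

variable {U}

theorem mem_cellOf (x : X) (k : ℕ) : x ∈ cellOf U x k := by
  induction k with
  | zero => exact Set.mem_univ x
  | succ k ih =>
    rw [cellOf]
    split_ifs with h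
    · exact ⟨ih, h⟩
    · exact ⟨ih, h⟩

theorem cellOf_succ_subset (x : X) (k : ℕ) : cellOf U x (k + 1) ⊆ cellOf U x k := by
  rw [cellOf]
  split_ifs
  · exact Set.inter_subset_left
  · exact Set.sdiff_subset

theorem mem_splitter_iff_of_mem_cellOf_succ {x y : X} {k : ℕ} (h : y ∈ cellOf U x (k + 1)) :
    y ∈ splitter U (cellOf U x k) ↔ x ∈ splitter U (cellOf U x k) := by
  rw [cellOf] at h
  split_ifs at h with hx
  · exact iff_of_true h.2 hx
  · exact iff_of_false h.2 hx

theorem cellOf_eq_of_mem {x y : X} {k : ℕ} (h : y ∈ cellOf U x k) :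
    cellOf U y k = cellOf U x k := by
  classical
  induction k with
  | zero => rfl
  | succ k ih =>
    have h1 := ih (cellOf_succ_subset x k h)
    rw [cellOf, cellOf, h1]
    exact if_congr (mem_splitter_iff_of_mem_cellOf_succ h) rfl rfl

theorem cellOf_eq_cell {s : ℕ → Bool} {x : X} (h : ∀ k, x ∈ cell U s k) (k : ℕ) :
    cellOf U x k = cell U s k ∧ code U x k = s k := by
  classical
  have step : ∀ k, x ∈ splitter U (cell U s k) ↔ s k = true := by
    intro k
    have h1 := h (k + 1)
    rw [cell] at h1
    split_ifs at h1 with hs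
    · exact iff_of_true h1.2 hs
    · exact iff_of_false h1.2 hs
  have hcell : cellOf U x k = cell U s k := by
    induction k with
    | zero => rfl
    | succ k ih =>
      rw [cellOf, cell, ih]
      exact if_congr (step k) rfl rfl
  refine ⟨hcell, ?_⟩
  rw [code, Bool.eq_iff_iff, decide_eq_true_iff, hcell]
  exact step k

/-- The index of the splitter strictly increases with the depth of the cell, because no part of a
cell is split by the set that has cut it out. -/
theorem not_splits_cellOf (x : X) (k : ℕ) : ∀ j < k, ¬ Splits (cellOf U x k) (U j) := by
  have mono : ∀ {W W' V : Set X}, W' ⊆ W → Splits W' V → Splits W V := fun hW h =>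
    ⟨h.1.mono (Set.inter_subset_inter_left _ hW), h.2.mono (Set.sdiff_subset_sdiff_left hW)⟩
  induction k with
  | zero => intro j hj; omega
  | succ k ih =>
    intro j hj hs
    have hs' := mono (cellOf_succ_subset x k) hs
    obtain rfl : j = k := by
      by_contra hne
      exact ih j (by omega) hs'
    classical
    have hex : ∃ n, Splits (cellOf U x j) (U n) := ⟨j, hs'⟩
    have hfind : Nat.find hex = j := le_antisymm (Nat.find_min' hex hs')
      (not_lt.1 fun hlt => ih _ hlt (Nat.find_spec hex))
    have hspl : splitter U (cellOf U x j) = U j := by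
      rw [splitter, dif_pos hex, hfind]
    rw [cellOf, hspl] at hs
    split_ifs at hs
    · obtain ⟨y, hy⟩ := hs.2
      exact hy.2 hy.1.2
    · obtain ⟨y, hy⟩ := hs.1
      exact hy.1.2 hy.2

theorem code_injective (hsep : ∀ x y : X, x ≠ y → ∃ n, x ∈ U n ∧ y ∉ U n) :
    Function.Injective (code U) := by
  classical
  intro x y hxy
  have hcell : ∀ k, cellOf U x k = cellOf U y k := by
    intro k
    induction k with
    | zero => rfl
    | succ k ih =>
      have h1 : x ∈ splitter U (cellOf U y k) ↔ y ∈ splitter U (cellOf U y k) := by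
        have := congrFun hxy k
        rwa [code, code, decide_eq_decide, ih] at this
      rw [cellOf, cellOf, ih]
      exact if_congr h1 rfl rfl
  by_contra hne
  obtain ⟨n, hx, hy⟩ := hsep x y hne
  refine not_splits_cellOf x (n + 1) n n.lt_succ_self
    ⟨⟨x, mem_cellOf x _, hx⟩, y, ?_, hy⟩
  rw [hcell]
  exact mem_cellOf y _

variable [TopologicalSpace X]

theorem isClopen_splitter (hU : ∀ n, IsClopen (U n)) (W : Set X) : IsClopen (splitter U W) := by
  rw [splitter]
  split_ifs
  · exact hU _
  · exact isClopen_empty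

theorem splits_splitter (hsep : ∀ x y : X, x ≠ y → ∃ n, x ∈ U n ∧ y ∉ U n)
    (hiso : ∀ x : X, ¬ IsOpen {x}) {W : Set X} (hW : IsOpen W) (hne : W.Nonempty) :
    Splits W (splitter U W) := by
  classical
  have hex : ∃ n, Splits W (U n) := by
    obtain ⟨x, hx⟩ := hne
    obtain ⟨y, hy, hyx⟩ : ∃ y ∈ W, y ≠ x := by
      by_contra! h
      refine hiso x ?_
      rwa [← Set.eq_singleton_iff_unique_mem.2 ⟨hx, h⟩]
    obtain ⟨n, hn, hn'⟩ := hsep y x hyx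
    exact ⟨n, ⟨y, hy, hn⟩, x, hx, hn'⟩
  rw [splitter, dif_pos hex]
  exact Nat.find_spec hex

theorem isClopen_cellOf (hU : ∀ n, IsClopen (U n)) (x : X) (k : ℕ) :
    IsClopen (cellOf U x k) := by
  induction k with
  | zero => exact isClopen_univ
  | succ k ih =>
    rw [cellOf]
    split_ifs
    · exact ih.inter (isClopen_splitter hU _)
    · exact ih.diff (isClopen_splitter hU _)

theorem continuous_code (hU : ∀ n, IsClopen (U n)) : Continuous (code U) := by
  refine continuous_pi fun k => IsLocallyConstant.continuous ?_
  refine (IsLocallyConstant.iff_exists_open _).2 fun x =>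
    ⟨cellOf U x (k + 1), (isClopen_cellOf hU x _).isOpen, mem_cellOf x _, fun y hy => ?_⟩
  rw [code, code, decide_eq_decide, cellOf_eq_of_mem (cellOf_succ_subset x k hy)]
  exact mem_splitter_iff_of_mem_cellOf_succ hy

theorem code_surjective [CompactSpace X] [Nonempty X] (hU : ∀ n, IsClopen (U n))
    (hsep : ∀ x y : X, x ≠ y → ∃ n, x ∈ U n ∧ y ∉ U n) (hiso : ∀ x : X, ¬ IsOpen {x}) :
    Function.Surjective (code U) := by
  intro s
  have hcell : ∀ k, IsClopen (cell U s k) ∧ (cell U s k).Nonempty := by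
    intro k
    induction k with
    | zero => exact ⟨isClopen_univ, Set.univ_nonempty⟩
    | succ k ih =>
      have hspl := splits_splitter hsep hiso ih.1.isOpen ih.2
      rw [cell]
      split_ifs
      · exact ⟨ih.1.inter (isClopen_splitter hU _), hspl.1⟩
      · exact ⟨ih.1.diff (isClopen_splitter hU _), hspl.2⟩
  obtain ⟨x, hx⟩ := IsCompact.nonempty_iInter_of_sequence_nonempty_isCompact_isClosed (cell U s)
    (fun k => by
      rw [cell]
      split_ifs
      · exact Set.inter_subset_left
      · exact Set.sdiff_subset)
    (fun k => (hcell k).2) (hcell 0).1.isClosed.isCompact (fun k => (hcell k).1.isClosed)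
  exact ⟨x, funext fun k => (cellOf_eq_cell (Set.mem_iInter.1 hx) k).2⟩

end BinarySplitting

/-- Brouwer's characterization of the Cantor set. -/
theorem nonempty_homeomorph_cantorSet {X : Type*} [TopologicalSpace X] [CompactSpace X]
    [Nonempty X] {U : ℕ → Set X} (hU : ∀ n, IsClopen (U n))
    (hsep : ∀ x y : X, x ≠ y → ∃ n, x ∈ U n ∧ y ∉ U n) (hiso : ∀ x : X, ¬ IsOpen {x}) :
    Nonempty (X ≃ₜ cantorSet) :=
  ⟨(Continuous.homeoOfEquivCompactToT2 (f := Equiv.ofBijective (BinarySplitting.code U)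
    ⟨BinarySplitting.code_injective hsep, BinarySplitting.code_surjective hU hsep hiso⟩)
    (BinarySplitting.continuous_code hU)).trans cantorSetHomeomorphNatToBool.symm⟩

end Topology

/-! ### Rank-one abelian groups -/

section Rank

variable {G : Type*} [Group G]

/-- If every element `g` satisfies a relation `g ^ n = f ^ m`, then `g ↦ m / n` is an embedding. -/
theorem exists_injective_addMonoidHom_rat [Nontrivial G]
    (tf : ∀ g : G, g ≠ 1 → ¬ IsOfFinOrder g) (hcomm : ∀ a b : G, a * b = b * a)
    (hr : (⊤ : Subgroup G).RankLeOne) : ∃ φ : Additive G →+ ℚ, Function.Injective φ := by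
  obtain ⟨f, -, hf⟩ := hr
  replace hf := fun g : G => hf g (mem_top g)
  choose n hn m hm using hf
  have hf1 : f ≠ 1 := by
    rintro rfl
    obtain ⟨g, hg⟩ := exists_ne (1 : G)
    exact tf g hg (isOfFinOrder_iff_pow_eq_one.2
      ⟨n g, Nat.pos_of_ne_zero (hn g), by simpa using hm g⟩)
  have hinj : Function.Injective fun k : ℤ => f ^ k :=
    injective_zpow_iff_not_isOfFinOrder.2 (tf f hf1)
  have hn' : ∀ g, (n g : ℚ) ≠ 0 := fun g => Nat.cast_ne_zero.2 (hn g)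
  -- The quotient of the exponents in a relation `g ^ N = f ^ M` depends on `g` only.
  have huniq : ∀ (g : G) (N : ℕ) (M : ℤ), N ≠ 0 → g ^ N = f ^ M →
      (m g : ℚ) / n g = M / N := by
    intro g N M hN h
    have h1 : f ^ (m g * N) = f ^ (M * n g) := by
      rw [zpow_mul, zpow_mul, ← hm, ← h, zpow_natCast, zpow_natCast, ← pow_mul, ← pow_mul,
        mul_comm]
    have h2 : m g * N = M * n g := hinj h1
    rw [div_eq_div_iff (hn' g) (Nat.cast_ne_zero.2 hN)]
    exact_mod_cast h2
  let φ : Additive G →+ ℚ := AddMonoidHom.mk' (fun g => (m g.toMul : ℚ) / n g.toMul) (by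
    intro a b
    have h1 := huniq (a.toMul * b.toMul) (n a.toMul * n b.toMul)
      (m a.toMul * n b.toMul + m b.toMul * n a.toMul) (mul_ne_zero (hn _) (hn _)) (by
        rw [(show Commute a.toMul b.toMul from hcomm _ _).mul_pow, zpow_add, zpow_mul, zpow_mul,
          ← hm, ← hm, zpow_natCast, zpow_natCast, ← pow_mul, ← pow_mul,
          mul_comm (n b.toMul) (n a.toMul)])
    rw [toMul_add, h1, div_add_div _ _ (hn' _) (hn' _)]
    push_cast
    ring)
  refine ⟨φ, (injective_iff_map_eq_zero φ).2 fun a ha => ?_⟩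
  have h1 : (m a.toMul : ℚ) / n a.toMul = 0 := ha
  rw [div_eq_zero_iff, or_iff_left (hn' _), Int.cast_eq_zero] at h1
  by_contra hne
  refine tf a.toMul hne (isOfFinOrder_iff_pow_eq_one.2
    ⟨n a.toMul, Nat.pos_of_ne_zero (hn _), ?_⟩)
  rw [hm, h1, zpow_zero]

theorem isRankOneAbelian_of_rankLeOne [Nontrivial G]
    (tf : ∀ g : G, g ≠ 1 → ¬ IsOfFinOrder g) (hcomm : ∀ a b : G, a * b = b * a)
    (hr : (⊤ : Subgroup G).RankLeOne) : IsRankOneAbelian G := by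
  refine ⟨hcomm, ?_⟩
  obtain ⟨φ, hφ⟩ := exists_injective_addMonoidHom_rat tf hcomm hr
  have hmem : (1 : Cardinal) ∈ {c | ∃ (V : Type _) (_ : AddCommGroup V) (_ : Module ℚ V)
      (φ : Additive G →+ V), Function.Injective φ ∧ c = Module.rank ℚ V} :=
    ⟨ULift ℚ, inferInstance, inferInstance,
      (AddEquiv.ulift.symm : ℚ ≃+ ULift ℚ).toAddMonoidHom.comp φ,
      (AddEquiv.ulift.symm : ℚ ≃+ ULift ℚ).injective.comp hφ, by simp⟩
  refine le_antisymm (csInf_le' hmem) (le_csInf ⟨1, hmem⟩ ?_)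
  rintro _ ⟨V, _, _, ψ, hψ, rfl⟩
  have : Nontrivial V := hψ.nontrivial
  exact Cardinal.one_le_iff_pos.2 rank_pos

end Rank

theorem GroupOrdering.not_isOpen_singleton {G : Type*} [Group G] [Nontrivial G]
    [Group.IsNilpotent G] (not_rank_one : ¬ IsRankOneAbelian G) (o : GroupOrdering G) :
    ¬ IsOpen ({o} : Set (GroupOrdering G)) := by
  intro ho
  obtain ⟨F, hF⟩ := exists_isDeterminedBy_of_isOpen_singleton ho
  let _ := o.toLinearOrder
  have := o.mulLeftMono_toLinearOrder
  obtain ⟨hcomm, hr⟩ := hF.mul_comm_and_rankLeOne_top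
  exact not_rank_one (isRankOneAbelian_of_rankLeOne not_isOfFinOrder_of_leftOrdered hcomm hr)

theorem theoremB (G : Type*) [Group G] [Countable G] [Nontrivial G] [Group.IsNilpotent G]
    (torsion_free : ∀ g : G, g ≠ 1 → ¬ IsOfFinOrder g)
    (not_rank_one : ¬ IsRankOneAbelian G) :
    Nonempty (GroupOrdering G ≃ₜ cantorSet) ∧
      ∀ o : GroupOrdering G,
        ¬ ∃ S : Set G, S.Finite ∧ Subsemigroup.closure S = o.positiveCone := by
  have hiso := GroupOrdering.not_isOpen_singleton not_rank_one
  refine ⟨?_, fun o ⟨S, hS, h⟩ => hiso o (GroupOrdering.isOpen_singleton_of_closure_eq hS h)⟩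
  have := GroupOrdering.nonempty_of_torsionFree G torsion_free
  obtain ⟨e, he⟩ := exists_surjective_nat G
  refine nonempty_homeomorph_cantorSet
    (fun n => GroupOrdering.isClopen_setOf_one_lt (e n)) (fun o o' hne => ?_) hiso
  by_contra! h
  refine hne (GroupOrdering.eq_of_one_lt_imp fun g hg => ?_)
  obtain ⟨n, rfl⟩ := he g
  exact h n hg
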